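/- Let $L^2_+=\{f\in L^2(\mathbb{R},\mathbb{C}) : \operatorname{supp}\hat f\subset[0,+\infty)\}$ be the Hardy space, let $H^1_+=L^2_+\cap H^1(\mathbb{R})$, and let $\Pi:L^2(\mathbb{R})\to L^2_+$ be the Szegő projector, $\widehat{\Pi f}=\mathbf{1}_{[0,+\infty)}\hat f$. For a real-valued $u\in L^2(\mathbb{R},\mathbb{R})$, let $L_u=\mathrm{D}-T_u$ be the unbounded operator on $L^2_+$ with domain $H^1_+$, where $\mathrm{D}h=-i\partial_x h$ and $T_uh=\Pi(uh)$ for $h\in H^1_+$. Then: 1. $L_u$ is self-adjoint on $L^2_+$ with domain $\mathbf{D}(L_u)=H^1_+$. 2. $L_u$ is bounded from below: there is $m\in\mathbb{R}$ with $\langle L_uh,h\rangle_{L^2}\ge m\|h\|_{L^2}^2$ for all $h\in H^1_+$. 3. $\sigma_{\mathrm{ess}}(L_u)=\sigma_{\mathrm{ess}}(\mathrm{D})=[0,+\infty)$, where the essential spectrum of a self-adjoint operator is its spectrum with the isolated eigenvalues of finite multiplicity removed. 4. The set $\sigma_{\mathrm{pp}}(L_u)$ of eigenvalues of $L_u$ satisfies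 $\sigma_{\mathrm{pp}}(L_u)\subset\bigl[-\tfrac{C^2}{4}\|u\|_{L^2}^2,+\infty\bigr)$, both for $$C=\inf_{f\in H^1_+\setminus\{0\}}\frac{\||\mathrm{D}|^{1/4}f\|_{L^2}}{\|f\|_{L^4}}$$ and for the best constant of the Sobolev inequality $\|f\|_{L^4}\le C\,\||\mathrm{D}|^{1/4}f\|_{L^2}$ on $H^1_+$, that is, for $$C=\sup_{f\in H^1_+\setminus\{0\}}\frac{\|f\|_{L^4}}{\||\mathrm{D}|^{1/4}f\|_{L^2}}.$$ -/

import Mathlib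

open MeasureTheory FourierTransform
open scoped SchwartzMap LineDeriv ContDiff

namespace LaxOperator

/-! ### Unbounded operators on a complex Hilbert space -/

section Operators

variable {E : Type*} [NormedAddCommGroup E] [NormedSpace ℂ E]

/-- The resolvent set of an unbounded operator `A`: the complex numbers `z` for which
`z - A : D(A) → E` is bijective with a bounded inverse `R`. -/
def resolventSet (A : E →ₗ.[ℂ] E) : Set ℂ :=
  {z | ∃ R : E →L[ℂ] E,
    (∀ y : E, ∃ h : R y ∈ A.domain, z • R y - A ⟨R y, h⟩ = y) ∧
    ∀ x : A.domain, R (z • (x : E) - A x) = x}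

/-- The spectrum of an unbounded operator. -/
def spectrum (A : E →ₗ.[ℂ] E) : Set ℂ := (resolventSet A)ᶜ

/-- The kernel of `A - z`, as a subspace of the domain of `A`. -/
def eigenspace (A : E →ₗ.[ℂ] E) (z : ℂ) : Submodule ℂ A.domain :=
  LinearMap.ker (A.toFun - z • A.domain.subtype)

/-- The pure point spectrum: the set of all eigenvalues. -/
def pointSpectrum (A : E →ₗ.[ℂ] E) : Set ℂ :=
  {z | ∃ x : A.domain, (x : E) ≠ 0 ∧ A x = z • (x : E)}

/-- The discrete spectrum of a self-adjoint operator: the eigenvalues of finite multiplicity that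
are isolated points of the spectrum. -/
def discreteSpectrum (A : E →ₗ.[ℂ] E) : Set ℂ :=
  {z | z ∈ pointSpectrum A ∧ FiniteDimensional ℂ (eigenspace A z) ∧
    ∃ ε > 0, spectrum A ∩ Metric.ball z ε = {z}}

/-- The essential spectrum of a self-adjoint operator: the complement, inside the spectrum, of the
discrete spectrum. -/
def essentialSpectrum (A : E →ₗ.[ℂ] E) : Set ℂ := spectrum A \ discreteSpectrum A

end Operators

/-! ### The Hardy space, the Szegő projector and `H¹₊`

The Fourier transform is `𝓕 f ξ = ∫ exp (-2 π i x ξ) f x dx`, extended to `L²`; the frequency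
denoted `ξ` in the convention `∫ exp (-i x ξ) f x dx` is therefore `2 π ξ` here. -/

/-- The complex Hilbert space `L²(ℝ)`. -/
abbrev L2 : Type := Lp ℂ 2 (volume : Measure ℝ)

/-- The Hardy space `L²₊`: the functions in `L²(ℝ)` whose Fourier transform is supported
in `[0, ∞)`. -/
noncomputable def hardySpace : Submodule ℂ L2 where
  carrier := {f | ∀ᵐ ξ : ℝ, ξ < 0 → (𝓕 f : L2) ξ = 0}
  zero_mem' := by
    have h : (𝓕 (0 : L2) : L2) = 0 := (Lp.fourierTransformₗᵢ ℝ ℂ).map_zero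
    simp only [Set.mem_ofPred_eq, h]
    filter_upwards [Lp.coeFn_zero ℂ 2 (volume : Measure ℝ)] with ξ hξ _
    rw [hξ, Pi.zero_apply]
  add_mem' := by
    intro f g hf hg
    simp only [Set.mem_ofPred_eq, FourierAdd.fourier_add] at *
    filter_upwards [hf, hg, Lp.coeFn_add (𝓕 f : L2) (𝓕 g : L2)] with ξ h1 h2 h3 hξ
    rw [h3, Pi.add_apply, h1 hξ, h2 hξ, add_zero]
  smul_mem' := by
    intro c f hf
    simp only [Set.mem_ofPred_eq, FourierSMul.fourier_smul] at *
    filter_upwards [hf, Lp.coeFn_smul c (𝓕 f : L2)] with ξ h1 h2 hξ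
    rw [h2, Pi.smul_apply, h1 hξ, smul_zero]

theorem mem_hardySpace {f : L2} :
    f ∈ hardySpace ↔ ∀ᵐ ξ : ℝ, ξ < 0 → (𝓕 f : L2) ξ = 0 := Iff.rfl

/-- Multiplication of an `L²` function by the indicator function of `[0, ∞)`. -/
noncomputable def cutoff : L2 →ₗ[ℂ] L2 where
  toFun f := ((Lp.memLp f).indicator (measurableSet_Ici (a := (0 : ℝ)))).toLp _
  map_add' f g := by
    ext1
    filter_upwards [((Lp.memLp f).indicator (measurableSet_Ici (a := (0 : ℝ)))).coeFn_toLp,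
      ((Lp.memLp g).indicator (measurableSet_Ici (a := (0 : ℝ)))).coeFn_toLp,
      ((Lp.memLp (f + g)).indicator (measurableSet_Ici (a := (0 : ℝ)))).coeFn_toLp,
      Lp.coeFn_add f g,
      Lp.coeFn_add (((Lp.memLp f).indicator (measurableSet_Ici (a := (0 : ℝ)))).toLp _)
        (((Lp.memLp g).indicator (measurableSet_Ici (a := (0 : ℝ)))).toLp _)]
      with x h1 h2 h3 h4 h5
    rw [h3, h5, Pi.add_apply, h1, h2]
    by_cases hx : x ∈ Set.Ici (0 : ℝ) <;> simp_all
  map_smul' c f := by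
    ext1
    filter_upwards [((Lp.memLp f).indicator (measurableSet_Ici (a := (0 : ℝ)))).coeFn_toLp,
      ((Lp.memLp (c • f)).indicator (measurableSet_Ici (a := (0 : ℝ)))).coeFn_toLp,
      Lp.coeFn_smul c f,
      Lp.coeFn_smul c (((Lp.memLp f).indicator (measurableSet_Ici (a := (0 : ℝ)))).toLp _)]
      with x h1 h2 h3 h4
    rw [RingHom.id_apply, h2, h4, Pi.smul_apply, h1]
    by_cases hx : x ∈ Set.Ici (0 : ℝ) <;> simp_all

theorem cutoff_coeFn (f : L2) :
    (cutoff f : ℝ → ℂ) =ᵐ[volume] (Set.Ici (0 : ℝ)).indicator f :=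
  ((Lp.memLp f).indicator (measurableSet_Ici (a := (0 : ℝ)))).coeFn_toLp

theorem norm_cutoff_le (f : L2) : ‖cutoff f‖ ≤ ‖f‖ := by
  apply Lp.norm_le_norm_of_ae_le
  filter_upwards [cutoff_coeFn f] with x hx
  rw [hx]
  exact norm_indicator_le_norm_self _ _

theorem mem_hardySpace_iff_cutoff {f : L2} : f ∈ hardySpace ↔ cutoff (𝓕 f) = 𝓕 f := by
  rw [mem_hardySpace]
  constructor
  · intro h
    ext1
    filter_upwards [h, cutoff_coeFn (𝓕 f)] with x h1 h2
    rw [h2]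
    by_cases hx : x ∈ Set.Ici (0 : ℝ)
    · simp [hx]
    · rw [Set.indicator_of_notMem hx, h1 (by simpa using hx)]
  · intro h
    filter_upwards [cutoff_coeFn (𝓕 f)] with x h2 hx
    rw [← h, h2, Set.indicator_of_notMem (by simpa using hx)]

theorem continuous_cutoff : Continuous cutoff :=
  (cutoff.mkContinuous 1 (fun f => by simpa using norm_cutoff_le f)).continuous

theorem isClosed_hardySpace : IsClosed (hardySpace : Set L2) := by
  have h : (hardySpace : Set L2) = {f | cutoff (𝓕 f) = 𝓕 f} := by
    ext f
    exact mem_hardySpace_iff_cutoff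
  have hF : Continuous (fun f : L2 => (𝓕 f : L2)) := (Lp.fourierTransformₗᵢ ℝ ℂ).continuous
  rw [h]
  exact isClosed_eq (continuous_cutoff.comp hF) hF

instance : CompleteSpace hardySpace := isClosed_hardySpace.completeSpace_coe

/-- The Szegő projector `Π : L²(ℝ) → L²₊`, the Fourier multiplier by the indicator function of
`[0, ∞)`. -/
noncomputable def szego : L2 →ₗ[ℂ] hardySpace where
  toFun f := ⟨𝓕⁻ (cutoff (𝓕 f)), by
    rw [mem_hardySpace, fourier_fourierInv_eq]
    filter_upwards [cutoff_coeFn (𝓕 f)] with x h2 hx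
    rw [h2, Set.indicator_of_notMem (by simpa using hx)]⟩
  map_add' f g := by
    ext1
    simp [FourierAdd.fourier_add, FourierInvAdd.fourierInv_add]
  map_smul' c f := by
    ext1
    simp [FourierSMul.fourier_smul, FourierInvSMul.fourierInv_smul]

/-- The embedding of `L²(ℝ)` into tempered distributions. -/
noncomputable def toDist : L2 →ₗ[ℂ] 𝓢'(ℝ, ℂ) :=
  (Lp.toTemperedDistributionCLM ℂ (volume : Measure ℝ) 2).toLinearMap

theorem toDist_apply (f : L2) (φ : 𝓢(ℝ, ℂ)) : toDist f φ = ∫ x, φ x • f x :=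
  Lp.toTemperedDistribution_apply f φ

theorem toDist_injective : Function.Injective toDist :=
  LinearMap.ker_eq_bot.mp Lp.ker_toTemperedDistributionCLM_eq_bot

/-- The space `H¹₊ = L²₊ ∩ H¹(ℝ)`. -/
noncomputable def sobolevPlus : Submodule ℂ hardySpace where
  carrier := {h | TemperedDistribution.MemSobolev 1 2 (toDist h)}
  zero_mem' := by
    simp only [Set.mem_ofPred_eq, ZeroMemClass.coe_zero, map_zero]
    exact TemperedDistribution.memSobolev_fun_zero ℝ ℂ 1 2
  add_mem' := by
    intro f g hf hg
    simp only [Set.mem_ofPred_eq, Submodule.coe_add, map_add] at *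
    exact hf.add hg
  smul_mem' := by
    intro c f hf
    simp only [Set.mem_ofPred_eq, Submodule.coe_smul, map_smul] at *
    exact hf.smul c

/-! ### The operator `D = -i ∂ₓ` -/

/-- A function in `H¹(ℝ)` has a distributional derivative in `L²(ℝ)`. -/
theorem exists_deriv {f : L2} (hf : TemperedDistribution.MemSobolev 1 2 (toDist f)) :
    ∃ g : L2, toDist g = ∂_{(1 : ℝ)} (toDist f) := by
  have h := hf.lineDerivOp (m := (1 : ℝ))
  rw [sub_self, TemperedDistribution.memSobolev_zero_iff] at h
  obtain ⟨g, hg⟩ := h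
  exact ⟨g, hg.symm⟩

/-- Differentiation is multiplication by `2 π i ξ` on the Fourier side. -/
theorem fourier_deriv {f g : L2} (h : toDist g = ∂_{(1 : ℝ)} (toDist f)) :
    ((𝓕 g : L2) : ℝ → ℂ) =ᵐ[volume] fun ξ => (2 * Real.pi * Complex.I * ξ) * (𝓕 f : L2) ξ := by
  have h1 : toDist (𝓕 g) = (2 * Real.pi * Complex.I) •
      TemperedDistribution.smulLeftCLM ℂ (fun x : ℝ => ((inner ℝ x (1 : ℝ) : ℝ) : ℂ))
        (toDist (𝓕 f)) := by
    have e1 : toDist (𝓕 g) = 𝓕 (toDist g) := (Lp.fourier_toTemperedDistribution_eq g).symm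
    have e2 : toDist (𝓕 f) = 𝓕 (toDist f) := (Lp.fourier_toTemperedDistribution_eq f).symm
    rw [e1, e2, h, TemperedDistribution.fourier_lineDerivOp_eq]
  have lf : LocallyIntegrable ((𝓕 f : L2) : ℝ → ℂ) volume :=
    (Lp.memLp _).locallyIntegrable (by norm_num)
  have lg : LocallyIntegrable ((𝓕 g : L2) : ℝ → ℂ) volume :=
    (Lp.memLp _).locallyIntegrable (by norm_num)
  apply ae_eq_of_integral_contDiff_smul_eq lg
  · rw [← locallyIntegrableOn_univ] at lf ⊢
    exact lf.continuousOn_mul (by fun_prop) isClosed_univ.isLocallyClosed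
  · intro φ φ_smooth φ_cpt
    have hg₁ : HasCompactSupport (Complex.ofRealCLM ∘ φ) := φ_cpt.comp_left rfl
    have hg₂ : ContDiff ℝ ∞ (Complex.ofRealCLM ∘ φ) :=
      Complex.ofRealCLM.contDiff.comp φ_smooth
    have h2 := congrArg (fun T : 𝓢'(ℝ, ℂ) => T (hg₁.toSchwartzMap hg₂)) h1
    have ht : Function.HasTemperateGrowth (fun x : ℝ => ((inner ℝ x (1 : ℝ) : ℝ) : ℂ)) := by
      fun_prop
    have h3 (T : 𝓢'(ℝ, ℂ)) (c : ℂ) (ψ : 𝓢(ℝ, ℂ)) : (c • T) ψ = c • T ψ := rfl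
    simp only [h3, TemperedDistribution.smulLeftCLM_apply_apply, toDist_apply,
      ← integral_smul] at h2
    refine Eq.trans ?_ (h2.trans ?_)
    · apply integral_congr_ae
      filter_upwards with x
      simp
    · apply integral_congr_ae
      filter_upwards with x
      rw [SchwartzMap.smulLeftCLM_apply_apply ht]
      simp
      ring

theorem deriv_mem_hardySpace {f g : L2} (hf : f ∈ hardySpace)
    (h : toDist g = ∂_{(1 : ℝ)} (toDist f)) : g ∈ hardySpace := by
  rw [mem_hardySpace] at *
  filter_upwards [hf, fourier_deriv h] with x h1 h2 hx
  rw [h2, h1 hx, mul_zero]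

/-- The distributional derivative of a function in `H¹₊`, as an element of `L²₊`. -/
theorem exists_deriv_hardySpace (h : sobolevPlus) :
    ∃ g : hardySpace, toDist g = ∂_{(1 : ℝ)} (toDist (h : hardySpace)) := by
  obtain ⟨g, hg⟩ := exists_deriv h.2
  exact ⟨⟨g, deriv_mem_hardySpace (h : hardySpace).2 hg⟩, hg⟩

/-- The distributional derivative `∂ₓ : H¹₊ → L²₊`. -/
noncomputable def deriv : sobolevPlus →ₗ[ℂ] hardySpace where
  toFun h := (exists_deriv_hardySpace h).choose
  map_add' f g := by
    apply Subtype.val_injective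
    apply toDist_injective
    rw [(exists_deriv_hardySpace (f + g)).choose_spec, Submodule.coe_add, Submodule.coe_add,
      Submodule.coe_add, map_add, map_add, (exists_deriv_hardySpace f).choose_spec,
      (exists_deriv_hardySpace g).choose_spec]
    exact LineDeriv.lineDerivOp_add _ _ _
  map_smul' c f := by
    apply Subtype.val_injective
    apply toDist_injective
    rw [(exists_deriv_hardySpace (c • f)).choose_spec, Submodule.coe_smul, Submodule.coe_smul,
      RingHom.id_apply, Submodule.coe_smul, map_smul, map_smul,
      (exists_deriv_hardySpace f).choose_spec]
    exact LineDeriv.lineDerivOp_smul _ _ _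

theorem toDist_deriv (h : sobolevPlus) :
    toDist (deriv h) = ∂_{(1 : ℝ)} (toDist (h : hardySpace)) :=
  (exists_deriv_hardySpace h).choose_spec

/-- The operator `D = -i ∂ₓ` on `L²₊` with domain `H¹₊`. -/
noncomputable def opD : hardySpace →ₗ.[ℂ] hardySpace where
  domain := sobolevPlus
  toFun := (-Complex.I) • deriv

/-! ### Toeplitz operators and the Lax operator -/

/-- Functions in `H¹(ℝ)` are essentially bounded. -/
theorem memLp_top {f : L2} (hf : TemperedDistribution.MemSobolev 1 2 (toDist f)) :
    MemLp (f : ℝ → ℂ) ⊤ volume := by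
  obtain ⟨v, hv⟩ := hf.fourier_memL1 (by simp)
  have key : (f : ℝ → ℂ) =ᵐ[volume] (Real.Lp.fourierTransformInv v : ℝ → ℂ) := by
    apply ae_eq_of_integral_contDiff_smul_eq
    · exact (Lp.memLp f).locallyIntegrable (by norm_num)
    · exact (Real.Lp.fourierTransformInv v).continuous.locallyIntegrable
    · intro φ φ_smooth φ_cpt
      have hg₁ : HasCompactSupport (Complex.ofRealCLM ∘ φ) := φ_cpt.comp_left rfl
      have hg₂ : ContDiff ℝ ∞ (Complex.ofRealCLM ∘ φ) :=
        Complex.ofRealCLM.contDiff.comp φ_smooth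
      set ψ : 𝓢(ℝ, ℂ) := hg₁.toSchwartzMap hg₂ with hψ
      have hψx : ∀ x, ψ x = (φ x : ℂ) := fun x => by simp [hψ]
      have h1 : toDist f ψ = (𝓕 (toDist f)) (𝓕⁻ ψ) := by
        rw [TemperedDistribution.fourier_apply, fourier_fourierInv_eq]
      rw [hv, toDist_apply, Lp.toTemperedDistribution_apply] at h1
      have h2 := VectorFourier.integral_fourierIntegral_smul_eq_flip (L := -innerₗ ℝ)
        (μ := volume) (ν := volume) Real.continuous_fourierChar
        (by
          have : Continuous fun p : ℝ × ℝ => -(p.2 * p.1) := by fun_prop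
          simpa using this) ψ.integrable (L1.integrable_coeFn v)
      refine Eq.trans ?_ (h1.trans (Eq.trans ?_ (h2.trans ?_)))
      · apply integral_congr_ae
        filter_upwards with x
        simp [hψx]
      · rw [SchwartzMap.fourierInv_coe]
        rfl
      · apply integral_congr_ae
        filter_upwards with x
        rw [hψx, Real.Lp.fourierTransformInv_apply]
        simp only [Complex.real_smul, smul_eq_mul]
        congr 1
        simp [Real.fourierInv_eq, VectorFourier.fourierIntegral, mul_comm]
  exact (memLp_congr_ae key).mpr (Real.Lp.fourierTransformInv v).memLp_top

/-- The product of a real function in `L²(ℝ)` and a function in `H¹₊` is in `L²(ℝ)`. -/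
theorem memLp_mul (u : Lp ℝ 2 (volume : Measure ℝ)) (h : sobolevPlus) :
    MemLp (fun x => (u x : ℂ) * ((h : hardySpace) : L2) x) 2 volume := by
  have hu : MemLp (fun x => (u x : ℂ)) 2 volume := (Lp.memLp u).ofReal
  exact (memLp_top h.2).mul hu

/-- The pointwise product `u h` of `u ∈ L²(ℝ, ℝ)` and `h ∈ H¹₊`, as an element of `L²(ℝ)`. -/
noncomputable def mulBy (u : Lp ℝ 2 (volume : Measure ℝ)) : sobolevPlus →ₗ[ℂ] L2 where
  toFun h := (memLp_mul u h).toLp _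
  map_add' f g := by
    rw [← MemLp.toLp_add]
    apply MemLp.toLp_congr
    filter_upwards [Lp.coeFn_add ((f : hardySpace) : L2) ((g : hardySpace) : L2)] with x hx
    simp only [Submodule.coe_add, Pi.add_apply, hx]
    ring
  map_smul' c f := by
    rw [RingHom.id_apply, ← MemLp.toLp_const_smul]
    apply MemLp.toLp_congr
    filter_upwards [Lp.coeFn_smul c ((f : hardySpace) : L2)] with x hx
    simp only [Submodule.coe_smul, Pi.smul_apply, hx, smul_eq_mul]
    ring

/-- The Toeplitz operator `T_u h = Π (u h)` on `L²₊` with domain `H¹₊`. -/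
noncomputable def toeplitz (u : Lp ℝ 2 (volume : Measure ℝ)) : hardySpace →ₗ.[ℂ] hardySpace where
  domain := sobolevPlus
  toFun := szego ∘ₗ mulBy u

/-- The Lax operator `L_u = D - T_u`. -/
noncomputable def lax (u : Lp ℝ 2 (volume : Measure ℝ)) : hardySpace →ₗ.[ℂ] hardySpace :=
  opD - toeplitz u

/-! ### The Sobolev constant -/

/-- The norm `‖ |D|^s f ‖_{L²}`, where `|D|^s` is the Fourier multiplier by `|2 π ξ|^s`. -/
noncomputable def absDNorm (s : ℝ) (f : L2) : ℝ :=
  (eLpNorm (fun ξ : ℝ => (((2 * Real.pi * |ξ|) ^ s : ℝ) : ℂ) * (𝓕 f : L2) ξ) 2 volume).toReal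

/-- The norm `‖f‖_{L⁴}`. -/
noncomputable def L4Norm (f : L2) : ℝ := (eLpNorm (f : ℝ → ℂ) 4 volume).toReal

/-- The infimum of `‖ |D|^{1/4} f ‖_{L²} / ‖f‖_{L⁴}` over the nonzero `f` in `H¹₊`. -/
noncomputable def sobolevInf : ℝ :=
  ⨅ f : {f : sobolevPlus // f ≠ 0},
    absDNorm (1 / 4) ((f : sobolevPlus) : hardySpace) / L4Norm ((f : sobolevPlus) : hardySpace)

/-- The best constant `K` in the Sobolev inequality `‖f‖_{L⁴} ≤ K ‖ |D|^{1/4} f ‖_{L²}` on `H¹₊`: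
the supremum of `‖f‖_{L⁴} / ‖ |D|^{1/4} f ‖_{L²}` over the nonzero `f` in `H¹₊`. -/
noncomputable def sobolevSup : ℝ :=
  ⨆ f : {f : sobolevPlus // f ≠ 0},
    L4Norm ((f : sobolevPlus) : hardySpace) / absDNorm (1 / 4) ((f : sobolevPlus) : hardySpace)

end LaxOperator

/-!
The Lax operator `L_u = D - T_u` is treated as a relatively compact symmetric perturbation of `D`,
which is multiplication by `2 π ξ` on the Fourier side.

*Spectrum.* For `z` outside `[0, ∞)` one has `z - L_u = (1 + T_u (z - D)⁻¹) (z - D)`. The resolvent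
`(z - D)⁻¹` has the square integrable symbol `(z - 2 π ξ)⁻¹`, `ξ ≥ 0`, so that
`y ↦ u (z - D)⁻¹ y` is a Hilbert–Schmidt operator and `T_u (z - D)⁻¹` is compact
(`relCompactAt_toeplitzMap`). By the Fredholm alternative, `z` is in the resolvent set of `L_u` or
is an eigenvalue (`mem_resolventSet_or_mem_pointSpectrum`); in the latter case its eigenspace is
finite-dimensional, and symmetry together with compactness prevents eigenvalues from accumulating
at `z` (`exists_ball_of_relCompactAt`). Conversely, functions whose Fourier transform is
concentrated on a short interval near `s / 2π` are approximate eigenvectors of `L_u` for `s ≥ 0`,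
since their sup norm is small compared with their `L²` norm (`exists_approx_eigenvector`). Hence
the essential spectrum is `[0, ∞)`, for every `u`; the operator `D` is the case `u = 0`.

*Lower bound.* For `h` in the Hardy space, `‖h‖_{L⁴}² = ‖ĥ ⋆ ĥ‖_{L²}`, and the Cauchy–Schwarz
inequality with the weight `(t (ξ - t))^{1/2}` and the Beta integral `B(1/2, 1/2) = π` give
`‖h‖_{L⁴} ≤ ‖ |D|^{1/4} h ‖_{L²}` (`eLpNorm_four_le`). A Sobolev inequality with constant `κ` yields
`⟨L_u h, h⟩ ≥ -(κ⁴ / 4) ‖u‖² ‖h‖²` (`form_lower_bound`). As `κ = 1` is admissible, the best constant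
`K` is at most `1`, so `K⁴ ≤ K²`, while the infimum of the inverse quotient is at least `1`: the
eigenvalue bound holds with either constant.

*Self-adjointness.* A real number below the lower bound of the form is not an eigenvalue, hence lies
in the resolvent set, and a symmetric operator with a real point in its resolvent set is
self-adjoint (`isSelfAdjoint_of_mem_resolventSet`).
-/

namespace LaxOperator

/-! ### Symmetric operators and relatively compact perturbations -/

section Abstract

open Filter Topology

variable {E : Type*} [NormedAddCommGroup E] [InnerProductSpace ℂ E]

/-- Eigenvalues of a symmetric operator are real. -/
theorem conj_eq_self_of_mem_pointSpectrum {A : E →ₗ.[ℂ] E} (hA : A.IsFormalAdjoint A) {z : ℂ}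
    (hz : z ∈ pointSpectrum A) : (starRingEnd ℂ) z = z := by
  obtain ⟨x, hx0, hx⟩ := hz
  have h := hA x x
  rw [hx, inner_smul_left, inner_smul_right] at h
  exact mul_right_cancel₀ (inner_self_ne_zero.mpr hx0) h

/-- A lower bound of the quadratic form of a symmetric operator bounds its eigenvalues. -/
theorem pointSpectrum_subset_Ici {A : E →ₗ.[ℂ] E} (hA : A.IsFormalAdjoint A) {b : ℝ}
    (hb : ∀ x : A.domain, x ≠ 0 → b * ‖(x : E)‖ ^ 2 ≤ (inner ℂ (A x) (x : E)).re) :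
    pointSpectrum A ⊆ Complex.ofReal '' Set.Ici b := by
  intro z hz
  obtain ⟨r, rfl⟩ := Complex.conj_eq_iff_real.mp (conj_eq_self_of_mem_pointSpectrum hA hz)
  obtain ⟨x, hne, hx⟩ := hz
  refine ⟨r, ?_, rfl⟩
  have h1 := hb x fun h0 => hne (by rw [h0]; rfl)
  rw [hx, inner_smul_left, Complex.conj_ofReal, Complex.re_ofReal_mul,
    inner_self_eq_norm_sq_to_K] at h1
  have h2 : 0 < ‖(x : E)‖ ^ 2 := by
    have := norm_pos_iff.mpr hne
    positivity
  norm_cast at h1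
  exact le_of_mul_le_mul_right h1 h2

theorem inner_eq_zero_of_eigenvectors {A : E →ₗ.[ℂ] E} (hA : A.IsFormalAdjoint A) {z w : ℂ}
    (hzw : z ≠ w) {x y : A.domain} (hx0 : (x : E) ≠ 0) (hx : A x = z • (x : E))
    (hy : A y = w • (y : E)) : inner ℂ (x : E) (y : E) = 0 := by
  have h := hA x y
  rw [hx, hy, inner_smul_left, inner_smul_right,
    conj_eq_self_of_mem_pointSpectrum hA ⟨x, hx0, hx⟩] at h
  by_contra h0
  exact hzw (mul_right_cancel₀ h0 h)

/-- A point with approximate eigenvectors belongs to the spectrum. -/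
theorem mem_spectrum_of_approx {A : E →ₗ.[ℂ] E} {z : ℂ}
    (h : ∀ ε > 0, ∃ x : A.domain, (x : E) ≠ 0 ∧ ‖z • (x : E) - A x‖ ≤ ε * ‖(x : E)‖) :
    z ∈ spectrum A := by
  rintro ⟨R, -, hR⟩
  obtain ⟨x, hx0, hx⟩ := h (1 / (2 * (‖R‖ + 1))) (by positivity)
  have hpos : 0 < ‖(x : E)‖ := norm_pos_iff.mpr hx0
  have h1 : ‖(x : E)‖ ≤ ‖R‖ * (1 / (2 * (‖R‖ + 1)) * ‖(x : E)‖) := by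
    calc ‖(x : E)‖ = ‖R (z • (x : E) - A x)‖ := by rw [hR]
      _ ≤ ‖R‖ * ‖z • (x : E) - A x‖ := R.le_opNorm _
      _ ≤ _ := by gcongr
  have h2 : ‖R‖ * (1 / (2 * (‖R‖ + 1)) * ‖(x : E)‖) ≤ 1 / 2 * ‖(x : E)‖ := by
    rw [← mul_assoc]
    gcongr
    rw [mul_one_div, div_le_div_iff₀ (by positivity) (by norm_num)]
    linarith [norm_nonneg R]
  linarith

/-- A symmetric operator with a real point in its resolvent set is self-adjoint: surjectivity of
`A - c` forces both the density of the domain and the maximality of `A`. -/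
theorem isSelfAdjoint_of_mem_resolventSet [CompleteSpace E] {A : E →ₗ.[ℂ] E}
    (hA : A.IsFormalAdjoint A) {c : ℝ} (hc : (c : ℂ) ∈ resolventSet A) : IsSelfAdjoint A := by
  obtain ⟨R, hR, -⟩ := hc
  have hsymm (x y : A.domain) : inner ℂ ((c : ℂ) • (x : E) - A x) (y : E) =
      inner ℂ (x : E) ((c : ℂ) • (y : E) - A y) := by
    rw [inner_sub_left, inner_sub_right, inner_smul_left, inner_smul_right, hA x y,
      Complex.conj_ofReal]
  have hdense : Dense (A.domain : Set E) := by
    rw [Submodule.dense_iff_topologicalClosure_eq_top,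
      Submodule.topologicalClosure_eq_top_iff, Submodule.eq_bot_iff]
    intro w hw
    obtain ⟨hm, hw'⟩ := hR w
    have h0 : R w = 0 := by
      obtain ⟨hm2, hw2⟩ := hR (R w)
      have h1 := hsymm ⟨R (R w), hm2⟩ ⟨R w, hm⟩
      rw [hw', hw2] at h1
      rw [← inner_self_eq_zero (𝕜 := ℂ), h1]
      exact (Submodule.mem_orthogonal _ _).mp hw _ hm2
    rw [← hw']
    have : (⟨R w, hm⟩ : A.domain) = 0 := Subtype.ext h0
    rw [this, h0, A.map_zero, smul_zero, sub_zero]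
  rw [LinearPMap.isSelfAdjoint_def]
  refine (LinearPMap.eq_of_le_of_domain_eq (hA.le_adjoint hdense) ?_).symm
  refine le_antisymm (hA.le_adjoint hdense).1 fun y hy => ?_
  have hadj := LinearPMap.adjoint_isFormalAdjoint hdense (T := A) ⟨y, hy⟩
  obtain ⟨hm, hx⟩ := hR ((c : ℂ) • y - A.adjoint ⟨y, hy⟩)
  set x := R ((c : ℂ) • y - A.adjoint ⟨y, hy⟩) with hxdef
  have key (v : A.domain) : inner ℂ (y - x) ((c : ℂ) • (v : E) - A v) = 0 := by
    have h1 := hsymm ⟨x, hm⟩ v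
    rw [hx] at h1
    rw [inner_sub_left, ← h1, inner_sub_left, inner_sub_right, hadj v, inner_smul_left,
      inner_smul_right, Complex.conj_ofReal, sub_self]
  obtain ⟨hm3, h3⟩ := hR (y - x)
  have h4 := key ⟨_, hm3⟩
  rw [h3, inner_self_eq_zero, sub_eq_zero] at h4
  rw [h4]
  exact hm

/-- `z` lies in the resolvent set of `A₀`, with resolvent `R`, and the operator `V` is relatively
compact, in the sense that `V R` is a compact operator `K`. -/
def RelCompactAt {p : Submodule ℂ E} (A₀ V : p →ₗ[ℂ] E) (z : ℂ) : Prop :=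
  ∃ R K : E →L[ℂ] E,
    (∀ y, ∃ h : R y ∈ p, z • R y - A₀ ⟨R y, h⟩ = y ∧ V ⟨R y, h⟩ = K y) ∧
    (∀ x : p, R (z • (x : E) - A₀ x) = x) ∧ IsCompactOperator K

/-- Off the spectrum of `A₀`, the spectrum of `A₀ - V` consists of eigenvalues: the factorization
`z - A₀ + V = (1 + V R) (z - A₀)` reduces this to the Fredholm alternative for `V R`. -/
theorem mem_resolventSet_or_mem_pointSpectrum [CompleteSpace E] {p : Submodule ℂ E}
    {A₀ V : p →ₗ[ℂ] E} {z : ℂ} (h : RelCompactAt A₀ V z) :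
    z ∈ resolventSet (⟨p, A₀ - V⟩ : E →ₗ.[ℂ] E) ∨
      z ∈ pointSpectrum (⟨p, A₀ - V⟩ : E →ₗ.[ℂ] E) := by
  obtain ⟨R, K, hR, hL, hK⟩ := h
  rcases hK.hasEigenvalue_or_mem_resolventSet (μ := -1) (by simp) with he | hr
  · right
    obtain ⟨w, hw⟩ := he.exists_hasEigenvector
    have hw1 : K w = -w := by simpa using hw.apply_eq_smul
    obtain ⟨hm, h1, h2⟩ := hR w
    refine ⟨⟨R w, hm⟩, ?_, ?_⟩
    · intro h0
      have h0' : R w = 0 := h0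
      have : (⟨R w, hm⟩ : p) = 0 := Subtype.ext h0
      rw [this, h0', map_zero, smul_zero, sub_zero] at h1
      exact hw.2 h1.symm
    · change A₀ ⟨R w, hm⟩ - V ⟨R w, hm⟩ = z • R w
      rw [h2, hw1]
      linear_combination (norm := module) (-1 : ℂ) • h1
  · left
    rw [spectrum.mem_resolventSet_iff] at hr
    have hu : IsUnit (1 + K) := by
      rw [← IsUnit.neg_iff]
      convert hr using 1
      simp only [map_neg, map_one]
      abel
    obtain ⟨U, hU⟩ := hu
    have e1 (y : E) : (U⁻¹ : (E →L[ℂ] E)ˣ).val y + K ((U⁻¹ : (E →L[ℂ] E)ˣ).val y) = y := by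
      have := congrArg (fun T : E →L[ℂ] E => T y) U.mul_inv
      rw [hU] at this
      simpa using this
    have e2 (y : E) : (U⁻¹ : (E →L[ℂ] E)ˣ).val (y + K y) = y := by
      have := congrArg (fun T : E →L[ℂ] E => T y) U.inv_mul
      rw [hU] at this
      simpa using this
    refine ⟨R ∘L (U⁻¹ : (E →L[ℂ] E)ˣ).val, fun y => ?_, fun x => ?_⟩
    · obtain ⟨hm, h1, h2⟩ := hR ((U⁻¹ : (E →L[ℂ] E)ˣ).val y)
      refine ⟨hm, ?_⟩
      change z • R _ - (A₀ ⟨R _, hm⟩ - V ⟨R _, hm⟩) = y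
      rw [h2, ← sub_add]
      exact (congrArg (· + K ((U⁻¹ : (E →L[ℂ] E)ˣ).val y)) h1).trans (e1 y)
    · have hx := hL x
      obtain ⟨hm, h1, h2⟩ := hR (z • (x : E) - A₀ x)
      change R ((U⁻¹ : (E →L[ℂ] E)ˣ).val (z • (x : E) - (A₀ x - V x))) = x
      have hx' : (⟨_, hm⟩ : p) = x := Subtype.ext hx
      rw [hx'] at h2
      rw [← sub_add, h2, e2, hx]

/-- Off the spectrum of `A₀`, the eigenspaces of `A₀ - V` are finite-dimensional: `z - A₀` embeds
them into the eigenspace of the compact operator `V R` for the eigenvalue `-1`. -/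
theorem finiteDimensional_eigenspace {p : Submodule ℂ E}
    {A₀ V : p →ₗ[ℂ] E} {z : ℂ} (h : RelCompactAt A₀ V z) :
    FiniteDimensional ℂ (eigenspace (⟨p, A₀ - V⟩ : E →ₗ.[ℂ] E) z) := by
  obtain ⟨R, K, hR, hL, hK⟩ := h
  let N : Submodule ℂ E := LinearMap.ker ((1 + K : E →L[ℂ] E) : E →ₗ[ℂ] E)
  have hN (y : E) : y ∈ N ↔ K y = -y := by
    simp only [N, LinearMap.mem_ker]
    change y + K y = 0 ↔ _
    rw [add_comm, eq_neg_iff_add_eq_zero]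
  have hclosed : IsClosed (N : Set E) := (1 + K : E →L[ℂ] E).isClosed_ker
  have hmaps : ∀ y ∈ N, (-K : E →L[ℂ] E) y ∈ N := by
    intro y hy
    have : (-K : E →L[ℂ] E) y = y := by
      change -(K y) = y
      rw [(hN y).mp hy, neg_neg]
    rwa [this]
  have hcomp : IsCompactOperator (id : N → N) := by
    have h1 : IsCompactOperator ((-K : E →L[ℂ] E) : E →ₗ[ℂ] E) := hK.neg
    have h2 := h1.restrict (V := N) hmaps hclosed
    have h3 : ((((-K : E →L[ℂ] E) : E →ₗ[ℂ] E).restrict hmaps : N →ₗ[ℂ] N) : N → N) = id := by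
      ext y
      change -(K y) = y
      rw [(hN y).mp y.2, neg_neg]
    rwa [h3] at h2
  have : FiniteDimensional ℂ N := FiniteDimensional.of_isCompactOperator_id hcomp
  let f : p →ₗ[ℂ] E := z • p.subtype - A₀
  have hf (x : eigenspace (⟨p, A₀ - V⟩ : E →ₗ.[ℂ] E) z) : f (x : p) ∈ N := by
    have hx : A₀ (x : p) - V (x : p) - z • ((x : p) : E) = 0 := x.2
    rw [hN]
    obtain ⟨hm, h1, h2⟩ := hR (z • ((x : p) : E) - A₀ x)
    have hx' : (⟨_, hm⟩ : p) = x := Subtype.ext (hL x)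
    rw [hx'] at h2
    change K (z • ((x : p) : E) - A₀ x) = -(z • ((x : p) : E) - A₀ x)
    rw [← h2, ← sub_eq_zero, ← neg_eq_zero, ← hx]
    abel
  let g := (f ∘ₗ (eigenspace (⟨p, A₀ - V⟩ : E →ₗ.[ℂ] E) z).subtype).codRestrict N hf
  refine FiniteDimensional.of_injective g ?_
  intro x y hxy
  have hxy' : f (x : p) = f (y : p) := congrArg Subtype.val hxy
  apply Subtype.ext
  apply Subtype.ext
  rw [← hL x, ← hL y]
  exact congrArg R hxy'

/-- Off the spectrum of `A₀`, the eigenvalues of a symmetric operator `A₀ - V` do not accumulate.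
A sequence of eigenvectors `x n = R (w n)` with `‖w n‖ = 1` and eigenvalues tending to `z` would
subconverge, by compactness of `V R`, to an eigenvector for `z`, which is orthogonal to all of
them. -/
theorem exists_ball_of_relCompactAt {p : Submodule ℂ E}
    {A₀ V : p →ₗ[ℂ] E} {z : ℂ} (h : RelCompactAt A₀ V z)
    (hA : (⟨p, A₀ - V⟩ : E →ₗ.[ℂ] E).IsFormalAdjoint ⟨p, A₀ - V⟩) :
    ∃ ε > 0, ∀ w ∈ pointSpectrum (⟨p, A₀ - V⟩ : E →ₗ.[ℂ] E), w ∈ Metric.ball z ε → w = z := by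
  obtain ⟨R, K, hR, hL, hK⟩ := h
  by_contra hcon
  push Not at hcon
  have hseq (n : ℕ) : ∃ (v : ℂ) (w : E) (hm : R w ∈ p), ‖v - z‖ < 1 / ((n : ℝ) + 1) ∧ v ≠ z ∧
      ‖w‖ = 1 ∧ (A₀ - V) ⟨R w, hm⟩ = v • R w ∧ w + K w = (z - v) • R w := by
    obtain ⟨v, ⟨x, hx0, hx⟩, hv, hvz⟩ := hcon (1 / ((n : ℝ) + 1)) (by positivity)
    have hx' : (A₀ - V) x = v • (x : E) := hx
    set w₀ : E := z • (x : E) - A₀ x with hw₀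
    have hRw : R w₀ = x := hL x
    have hw0 : w₀ ≠ 0 := by
      intro h0
      rw [h0, map_zero] at hRw
      exact hx0 hRw.symm
    set c : ℂ := ((‖w₀‖⁻¹ : ℝ) : ℂ)
    have hRc : R (c • w₀) = ((c • x : p) : E) := by rw [map_smul, hRw]; rfl
    have hm : R (c • w₀) ∈ p := by rw [hRc]; exact (c • x).2
    have hpx : (⟨R (c • w₀), hm⟩ : p) = c • x := Subtype.ext hRc
    refine ⟨v, c • w₀, hm, ?_, hvz, ?_, ?_, ?_⟩
    · simpa [dist_eq_norm] using hv
    · rw [norm_smul, Complex.norm_real, norm_inv, norm_norm,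
        inv_mul_cancel₀ (norm_ne_zero_iff.mpr hw0)]
    · rw [hpx, map_smul, hx', hRc, Submodule.coe_smul, smul_comm]
    · obtain ⟨hm', h1, h2⟩ := hR (c • w₀)
      rw [← h2]
      nth_rewrite 1 [← h1]
      rw [hpx, hRc]
      have h3 : (A₀ - V) (c • x) = v • ((c • x : p) : E) := by
        rw [map_smul, hx', Submodule.coe_smul, smul_comm]
      rw [LinearMap.sub_apply] at h3
      rw [sub_smul, ← h3]
      abel
  choose v w hm hv hvz hw hAw hKw using hseq
  have hvlim : Tendsto v atTop (𝓝 z) := by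
    rw [tendsto_iff_norm_sub_tendsto_zero]
    exact squeeze_zero (fun _ => norm_nonneg _) (fun n => (hv n).le)
      tendsto_one_div_add_atTop_nhds_zero_nat
  obtain ⟨C, hC, hC'⟩ := hK.image_closedBall_subset_compact (f := (K : E →ₗ[ℂ] E)) 1
  obtain ⟨k, -, φ, hφ, hk⟩ := hC.tendsto_subseq (x := fun n => K (w n))
    (fun n => hC' ⟨w n, by simp [hw], rfl⟩)
  have hsmall : Tendsto (fun n => (z - v n) • R (w n)) atTop (𝓝 0) := by
    rw [tendsto_zero_iff_norm_tendsto_zero]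
    have hb : Tendsto (fun n => ‖z - v n‖ * ‖R‖) atTop (𝓝 0) := by
      have := ((tendsto_const_nhds (x := z)).sub hvlim).norm.mul_const ‖R‖
      simpa using this
    refine squeeze_zero (fun _ => norm_nonneg _) (fun n => ?_) hb
    rw [norm_smul]
    gcongr
    simpa [hw] using R.le_opNorm (w n)
  have hwlim : Tendsto (fun n => w (φ n)) atTop (𝓝 (-k)) := by
    have h1 := (hsmall.comp hφ.tendsto_atTop).sub hk
    rw [zero_sub] at h1
    refine h1.congr fun n => ?_
    simp only [Function.comp_apply]
    rw [← hKw]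
    abel
  have hnorm : ‖-k‖ = 1 := by
    have h1 := hwlim.norm
    simp only [hw] at h1
    exact tendsto_nhds_unique h1 tendsto_const_nhds
  have hKk : K (-k) = k := by
    exact tendsto_nhds_unique ((K.continuous.tendsto _).comp hwlim) hk
  obtain ⟨hmk, h1, h2⟩ := hR (-k)
  have hev : (⟨p, A₀ - V⟩ : E →ₗ.[ℂ] E) ⟨R (-k), hmk⟩ = z • R (-k) := by
    change A₀ ⟨R (-k), hmk⟩ - V ⟨R (-k), hmk⟩ = z • R (-k)
    rw [h2, hKk, ← sub_eq_zero, ← neg_eq_zero]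
    have h3 : z • R (-k) - A₀ ⟨R (-k), hmk⟩ + k = 0 := by rw [h1]; abel
    rw [← h3]
    abel
  have hne : ∀ n, R (w n) ≠ 0 := by
    intro n h0
    obtain ⟨hm', h1, -⟩ := hR (w n)
    have : (⟨R (w n), hm'⟩ : p) = 0 := Subtype.ext h0
    rw [this, h0, map_zero, smul_zero, sub_zero] at h1
    have := hw n
    rw [← h1, norm_zero] at this
    exact zero_ne_one this
  have horth (n : ℕ) : inner ℂ (R (w n)) (R (-k)) = 0 :=
    inner_eq_zero_of_eigenvectors hA (hvz n)
      (x := (⟨R (w n), hm n⟩ : p)) (y := (⟨R (-k), hmk⟩ : p)) (hne n) (hAw n) hev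
  have hRlim : Tendsto (fun n => R (w (φ n))) atTop (𝓝 (R (-k))) :=
    (R.continuous.tendsto _).comp hwlim
  have hzero : inner ℂ (R (-k)) (R (-k)) = 0 := by
    have h3 := Filter.Tendsto.inner (𝕜 := ℂ) hRlim (tendsto_const_nhds (x := R (-k)))
    simp only [horth] at h3
    exact (tendsto_nhds_unique h3 tendsto_const_nhds)
  have hRk : R (-k) = 0 := inner_self_eq_zero.mp hzero
  have : (⟨R (-k), hmk⟩ : p) = 0 := Subtype.ext hRk
  rw [this, hRk, map_zero, smul_zero, sub_zero] at h1
  rw [← h1, norm_zero] at hnorm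
  exact zero_ne_one hnorm

/-- **Weyl's theorem** on the stability of the essential spectrum, for a closed set `S` of points
that are not isolated in `S`: `V` is relatively compact with respect to `A₀` off `S`, and `A₀ - V`
has approximate eigenvectors at every point of `S`. -/
theorem essentialSpectrum_eq_of_relCompactAt [CompleteSpace E] {p : Submodule ℂ E}
    {A₀ V : p →ₗ[ℂ] E} (hA : (⟨p, A₀ - V⟩ : E →ₗ.[ℂ] E).IsFormalAdjoint ⟨p, A₀ - V⟩)
    {S : Set ℂ} (hS : IsClosed S) (hacc : ∀ z ∈ S, ∀ ε > 0, ∃ w ∈ S, w ∈ Metric.ball z ε ∧ w ≠ z)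
    (hcpt : ∀ z ∉ S, RelCompactAt A₀ V z)
    (happ : ∀ z ∈ S, ∀ ε > 0, ∃ x : p, (x : E) ≠ 0 ∧
      ‖z • (x : E) - (A₀ x - V x)‖ ≤ ε * ‖(x : E)‖) :
    essentialSpectrum (⟨p, A₀ - V⟩ : E →ₗ.[ℂ] E) = S := by
  have hsub : S ⊆ spectrum (⟨p, A₀ - V⟩ : E →ₗ.[ℂ] E) := fun z hz =>
    mem_spectrum_of_approx (happ z hz)
  ext z
  constructor
  · rintro ⟨hz, hzd⟩
    by_contra hzS
    have hpp := (mem_resolventSet_or_mem_pointSpectrum (hcpt z hzS)).resolve_left hz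
    obtain ⟨ε, hε, hball⟩ := exists_ball_of_relCompactAt (hcpt z hzS) hA
    obtain ⟨δ, hδ, hdisj⟩ := Metric.isOpen_iff.mp hS.isOpen_compl z hzS
    refine hzd ⟨hpp, finiteDimensional_eigenspace (hcpt z hzS), min ε δ, lt_min hε hδ, ?_⟩
    refine Set.Subset.antisymm ?_ ?_
    · rintro w ⟨hw, hwb⟩
      have hwS : w ∉ S := hdisj (Metric.ball_subset_ball (min_le_right _ _) hwb)
      exact hball w ((mem_resolventSet_or_mem_pointSpectrum (hcpt w hwS)).resolve_left hw)
        (Metric.ball_subset_ball (min_le_left _ _) hwb)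
    · rintro w rfl
      exact ⟨hz, Metric.mem_ball_self (lt_min hε hδ)⟩
  · intro hz
    refine ⟨hsub hz, ?_⟩
    rintro ⟨-, -, ε, hε, hiso⟩
    obtain ⟨w, hwS, hwb, hwz⟩ := hacc z hz ε hε
    have : w ∈ ({z} : Set ℂ) := by
      rw [← hiso]
      exact ⟨hsub hwS, hwb⟩
    exact hwz this

end Abstract

/-! ### `H¹₊` and `D` on the Fourier side -/

section Fourier

/-- A function in `L²` whose Fourier transform has a finite first moment in `L²` belongs to
`H¹`. -/
theorem memSobolev_of_memLp {f : L2} (hf : MemLp (fun ξ : ℝ => (ξ : ℂ) * (𝓕 f : L2) ξ) 2 volume) :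
    TemperedDistribution.MemSobolev 1 2 (toDist f) := by
  rw [TemperedDistribution.memSobolev_iff_exists_smulLeftCLM_fourier]
  set w : ℝ → ℂ := fun x => (((1 + ‖x‖ ^ 2) ^ ((1 : ℝ) / 2) : ℝ) : ℂ) with hw
  have hwc : Continuous w := by
    refine Complex.continuous_ofReal.comp ?_
    exact Continuous.rpow_const (by fun_prop) fun x => Or.inl (by positivity)
  have hG : MemLp (fun ξ => w ξ * (𝓕 f : L2) ξ) 2 volume := by
    refine MemLp.mono' ((Lp.memLp (𝓕 f : L2)).norm.add hf.norm)
      (hwc.aestronglyMeasurable.mul (Lp.aestronglyMeasurable _)) ?_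
    filter_upwards with ξ
    have h1 : ‖w ξ‖ ≤ 1 + |ξ| := by
      rw [hw, Complex.norm_real, Real.norm_of_nonneg (by positivity), ← Real.sqrt_eq_rpow]
      refine Real.sqrt_le_iff.mpr ⟨by positivity, ?_⟩
      rw [Real.norm_eq_abs]
      nlinarith [abs_nonneg ξ]
    rw [norm_mul, Pi.add_apply, norm_mul, Complex.norm_real ξ, Real.norm_eq_abs, ← one_add_mul]
    gcongr
  refine ⟨hG.toLp _, ?_⟩
  have e2 : 𝓕 (toDist f) = toDist (𝓕 f) := Lp.fourier_toTemperedDistribution_eq f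
  have ht : Function.HasTemperateGrowth w := by rw [hw]; fun_prop
  rw [e2]
  ext φ
  rw [TemperedDistribution.smulLeftCLM_apply_apply, toDist_apply,
    Lp.toTemperedDistribution_apply]
  apply integral_congr_ae
  filter_upwards [hG.coeFn_toLp] with x hx
  rw [hx, SchwartzMap.smulLeftCLM_apply_apply ht]
  simp only [smul_eq_mul]
  ring

/-- On `L¹ ∩ L²`, the inverse Fourier transform is given by the Fourier integral. -/
theorem fourierInv_ae_eq {g : L2} (hg : Integrable g) :
    ((𝓕⁻ g : L2) : ℝ → ℂ) =ᵐ[volume] 𝓕⁻ (g : ℝ → ℂ) := by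
  have hL : Continuous fun p : ℝ × ℝ => (-innerₗ ℝ) p.1 p.2 := by
    have : Continuous fun p : ℝ × ℝ => -(p.2 * p.1) := by fun_prop
    simpa using this
  have hcont : Continuous (𝓕⁻ (g : ℝ → ℂ)) :=
    VectorFourier.fourierIntegral_continuous Real.continuous_fourierChar hL hg
  apply ae_eq_of_integral_contDiff_smul_eq
  · exact (Lp.memLp _).locallyIntegrable (by norm_num)
  · exact hcont.locallyIntegrable
  · intro φ φ_smooth φ_cpt
    have hg₁ : HasCompactSupport (Complex.ofRealCLM ∘ φ) := φ_cpt.comp_left rfl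
    have hg₂ : ContDiff ℝ ∞ (Complex.ofRealCLM ∘ φ) :=
      Complex.ofRealCLM.contDiff.comp φ_smooth
    set ψ : 𝓢(ℝ, ℂ) := hg₁.toSchwartzMap hg₂ with hψ
    have hψx : ∀ x, ψ x = (φ x : ℂ) := fun x => by simp [hψ]
    have e : toDist (𝓕⁻ g) = 𝓕⁻ (toDist g) := (Lp.fourierInv_toTemperedDistribution_eq g).symm
    have h1 : toDist (𝓕⁻ g) ψ = toDist g (𝓕⁻ ψ) := by
      rw [e, TemperedDistribution.fourierInv_apply]
    rw [toDist_apply, toDist_apply] at h1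
    have h2 := VectorFourier.integral_fourierIntegral_smul_eq_flip (L := -innerₗ ℝ)
      (μ := volume) (ν := volume) Real.continuous_fourierChar hL ψ.integrable hg
    refine Eq.trans ?_ (h1.trans (Eq.trans ?_ (h2.trans ?_)))
    · apply integral_congr_ae
      filter_upwards with x
      simp [hψx]
    · rw [SchwartzMap.fourierInv_coe]
      rfl
    · apply integral_congr_ae
      filter_upwards with x
      rw [hψx]
      simp only [Complex.real_smul, smul_eq_mul]
      congr 1
      simp [Real.fourierInv_eq, VectorFourier.fourierIntegral, mul_comm]

/-- The action of `D = -i ∂ₓ` on `H¹₊`. -/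
noncomputable def momentum : sobolevPlus →ₗ[ℂ] hardySpace := (-Complex.I) • deriv

/-- The action of the Toeplitz operator `T_u` on `H¹₊`. -/
noncomputable def toeplitzMap (u : Lp ℝ 2 (volume : Measure ℝ)) : sobolevPlus →ₗ[ℂ] hardySpace :=
  szego ∘ₗ mulBy u

theorem opD_eq : opD = ⟨sobolevPlus, momentum⟩ := rfl

theorem lax_eq (u : Lp ℝ 2 (volume : Measure ℝ)) :
    lax u = ⟨sobolevPlus, momentum - toeplitzMap u⟩ := by
  refine LinearPMap.ext (inf_idem sobolevPlus) ?_
  intro x h1 h2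
  rfl

theorem toeplitzMap_zero : toeplitzMap 0 = 0 := by
  have h : mulBy 0 = 0 := by
    ext1 h
    ext1
    filter_upwards [(memLp_mul 0 h).coeFn_toLp, Lp.coeFn_zero ℝ 2 (volume : Measure ℝ),
      Lp.coeFn_zero ℂ 2 (volume : Measure ℝ)] with x h1 h2 h3
    change ((memLp_mul 0 h).toLp _ : L2) x = (0 : L2) x
    rw [h1, h2, h3]
    simp
  rw [toeplitzMap, h, LinearMap.comp_zero]

theorem fourier_momentum (h : sobolevPlus) :
    ((𝓕 (momentum h : L2) : L2) : ℝ → ℂ) =ᵐ[volume]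
      fun ξ => ((2 * Real.pi * ξ : ℝ) : ℂ) * (𝓕 ((h : hardySpace) : L2) : L2) ξ := by
  have e : ((momentum h : hardySpace) : L2) = (-Complex.I) • ((deriv h : hardySpace) : L2) := rfl
  rw [e, FourierSMul.fourier_smul]
  filter_upwards [Lp.coeFn_smul (-Complex.I) (𝓕 ((deriv h : hardySpace) : L2) : L2),
    fourier_deriv (toDist_deriv h)] with ξ h1 h2
  rw [h1, Pi.smul_apply, h2]
  push_cast
  simp only [smul_eq_mul]
  linear_combination (-2 * Real.pi * ξ * (𝓕 ((h : hardySpace) : L2) : L2) ξ) * Complex.I_sq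

theorem memLp_fourier_mul (h : sobolevPlus) :
    MemLp (fun ξ : ℝ => (ξ : ℂ) * (𝓕 ((h : hardySpace) : L2) : L2) ξ) 2 volume := by
  have h1 := (Lp.memLp (𝓕 (momentum h : L2) : L2)).const_mul ((2 * Real.pi : ℝ) : ℂ)⁻¹
  refine (memLp_congr_ae ?_).mp h1
  filter_upwards [fourier_momentum h] with ξ hξ
  rw [hξ]
  have : ((2 * Real.pi : ℝ) : ℂ) ≠ 0 := by
    exact_mod_cast Real.two_pi_pos.ne'
  push_cast at this ⊢
  field_simp

/-- The Fourier transform of a function in `H¹₊` is integrable. -/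
theorem integrable_fourier (h : sobolevPlus) :
    Integrable (𝓕 ((h : hardySpace) : L2) : L2) := by
  set f : L2 := 𝓕 ((h : hardySpace) : L2)
  have h1 := (Lp.memLp f).integrable_norm_pow (by norm_num)
  have h2 := (memLp_fourier_mul h).integrable_norm_pow (by norm_num)
  refine ((integrable_inv_one_add_sq.add h1).add h2).mono' (Lp.aestronglyMeasurable _) ?_
  filter_upwards with ξ
  have hpos : (0 : ℝ) < 1 + ξ ^ 2 := by positivity
  simp only [Pi.add_apply, norm_mul, Complex.norm_real, Real.norm_eq_abs]
  rw [mul_pow, sq_abs]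
  -- the inequality `a ≤ b⁻¹ + b a²` for `b = 1 + ξ²`
  have h3 : 0 ≤ (1 + ξ ^ 2)⁻¹ * (1 - (1 + ξ ^ 2) * ‖f ξ‖) ^ 2 := by positivity
  have h4 : (1 + ξ ^ 2)⁻¹ * (1 - (1 + ξ ^ 2) * ‖f ξ‖) ^ 2 =
      (1 + ξ ^ 2)⁻¹ - 2 * ‖f ξ‖ + (1 + ξ ^ 2) * ‖f ξ‖ ^ 2 := by
    field_simp
    ring
  nlinarith [norm_nonneg (f ξ)]

/-- Fourier inversion on `H¹₊`. -/
theorem ae_eq_fourierInv (h : sobolevPlus) :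
    (((h : hardySpace) : L2) : ℝ → ℂ) =ᵐ[volume]
      𝓕⁻ ((𝓕 ((h : hardySpace) : L2) : L2) : ℝ → ℂ) := by
  have h1 := fourierInv_ae_eq (integrable_fourier h)
  rwa [fourierInv_fourier_eq] at h1

/-- The bound `‖u h‖_{L²} ≤ ‖u‖_{L²} ‖ĥ‖_{L¹}`. -/
theorem norm_mulBy_le (u : Lp ℝ 2 (volume : Measure ℝ)) (h : sobolevPlus) :
    ‖mulBy u h‖ ≤ (∫ ξ, ‖(𝓕 ((h : hardySpace) : L2) : L2) ξ‖) * ‖u‖ := by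
  refine Lp.norm_le_mul_norm_of_ae_le_mul ?_
  filter_upwards [(memLp_mul u h).coeFn_toLp, ae_eq_fourierInv h] with x h1 h2
  change ‖((memLp_mul u h).toLp _ : L2) x‖ ≤ _
  rw [h1, norm_mul, Complex.norm_real, mul_comm, h2]
  gcongr
  exact VectorFourier.norm_fourierIntegral_le_integral_norm _ _ _ _ _

theorem norm_szego_le (f : L2) : ‖szego f‖ ≤ ‖f‖ := by
  change ‖(𝓕⁻ (cutoff (𝓕 f)) : L2)‖ ≤ _
  rw [← Lp.norm_fourier_eq, fourier_fourierInv_eq, ← Lp.norm_fourier_eq f]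
  exact norm_cutoff_le _

/-- The Szegő projector is self-adjoint. -/
theorem inner_szego_left (f : L2) (h : hardySpace) :
    inner ℂ (szego f) h = inner ℂ f (h : L2) := by
  change inner ℂ (𝓕⁻ (cutoff (𝓕 f)) : L2) (h : L2) = _
  rw [← Lp.inner_fourier_eq, fourier_fourierInv_eq, ← Lp.inner_fourier_eq f, L2.inner_def,
    L2.inner_def]
  apply integral_congr_ae
  filter_upwards [cutoff_coeFn (𝓕 f), mem_hardySpace.mp h.2] with ξ h1 h2
  rw [h1]
  by_cases hξ : ξ ∈ Set.Ici (0 : ℝ)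
  · rw [Set.indicator_of_mem hξ]
  · rw [h2 (by simpa using hξ), inner_zero_right, inner_zero_right]

theorem inner_momentum (h k : sobolevPlus) :
    inner ℂ (momentum h) (k : hardySpace) =
      ∫ ξ : ℝ, ((2 * Real.pi * ξ : ℝ) : ℂ) *
        inner ℂ ((𝓕 ((h : hardySpace) : L2) : L2) ξ) ((𝓕 ((k : hardySpace) : L2) : L2) ξ) := by
  change inner ℂ ((momentum h : hardySpace) : L2) ((k : hardySpace) : L2) = _
  rw [← Lp.inner_fourier_eq, L2.inner_def]
  apply integral_congr_ae
  filter_upwards [fourier_momentum h] with ξ h1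
  rw [h1]
  simp only [RCLike.inner_apply, map_mul, Complex.conj_ofReal]
  ring

theorem inner_toeplitzMap (u : Lp ℝ 2 (volume : Measure ℝ)) (h k : sobolevPlus) :
    inner ℂ (toeplitzMap u h) (k : hardySpace) =
      ∫ x, (u x : ℂ) * inner ℂ (((h : hardySpace) : L2) x) (((k : hardySpace) : L2) x) := by
  change inner ℂ (szego (mulBy u h)) (k : hardySpace) = _
  rw [inner_szego_left, L2.inner_def]
  apply integral_congr_ae
  filter_upwards [(memLp_mul u h).coeFn_toLp] with x h1
  change inner ℂ (((memLp_mul u h).toLp _ : L2) x) _ = _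
  rw [h1]
  simp only [RCLike.inner_apply, map_mul, Complex.conj_ofReal]
  ring

/-- The operator `L_u` is symmetric. -/
theorem isFormalAdjoint_lax (u : Lp ℝ 2 (volume : Measure ℝ)) :
    (⟨sobolevPlus, momentum - toeplitzMap u⟩ : hardySpace →ₗ.[ℂ] hardySpace).IsFormalAdjoint
      ⟨sobolevPlus, momentum - toeplitzMap u⟩ := by
  intro h k
  change inner ℂ (momentum h - toeplitzMap u h) (k : hardySpace) =
    inner ℂ (h : hardySpace) (momentum k - toeplitzMap u k)
  rw [inner_sub_left, inner_sub_right, ← inner_conj_symm _ (momentum k),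
    ← inner_conj_symm _ (toeplitzMap u k), inner_momentum h k, inner_momentum k h,
    inner_toeplitzMap u h k, inner_toeplitzMap u k h, ← integral_conj, ← integral_conj]
  simp only [map_mul, Complex.conj_ofReal, inner_conj_symm]

/-! ### The resolvent of `D` -/

/-- Fourier multiplication by an essentially bounded function. -/
noncomputable def multiplier (m : Lp ℂ ⊤ (volume : Measure ℝ)) : L2 →L[ℂ] L2 :=
  (Lp.fourierTransformₗᵢ ℝ ℂ).symm.toContinuousLinearEquiv.toContinuousLinearMap ∘L
    ((ContinuousLinearMap.mul ℂ ℂ).holderL volume ⊤ 2 2 m) ∘L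
    (Lp.fourierTransformₗᵢ ℝ ℂ).toContinuousLinearEquiv.toContinuousLinearMap

theorem fourier_multiplier (m : Lp ℂ ⊤ (volume : Measure ℝ)) (f : L2) :
    ((𝓕 (multiplier m f) : L2) : ℝ → ℂ) =ᵐ[volume] fun ξ => m ξ * (𝓕 f : L2) ξ := by
  have e : (𝓕 (multiplier m f) : L2) = (ContinuousLinearMap.mul ℂ ℂ).holder 2 m (𝓕 f : L2) :=
    (Lp.fourierTransformₗᵢ ℝ ℂ).apply_symm_apply _
  rw [e]
  exact (ContinuousLinearMap.mul ℂ ℂ).coeFn_holder m _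

/-- The symbol `(z - 2 π ξ)⁻¹` of the resolvent of `D`, extended by zero to negative
frequencies. -/
noncomputable def resolventSymbol (z : ℂ) : ℝ → ℂ :=
  (Set.Ici (0 : ℝ)).indicator fun ξ => (z - ((2 * Real.pi * ξ : ℝ) : ℂ))⁻¹

theorem measurable_resolventSymbol (z : ℂ) : Measurable (resolventSymbol z) :=
  Measurable.indicator (by fun_prop) measurableSet_Ici

theorem isClosed_ofReal_Ici : IsClosed (Complex.ofReal '' Set.Ici (0 : ℝ)) :=
  Complex.isometry_ofReal.isClosedEmbedding.isClosedMap _ isClosed_Ici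

theorem exists_norm_resolventSymbol_le {z : ℂ} (hz : z ∉ Complex.ofReal '' Set.Ici (0 : ℝ)) :
    ∃ c : ℝ, 0 ≤ c ∧ ∀ ξ : ℝ, ‖resolventSymbol z ξ‖ * (1 + |ξ|) ≤ c := by
  obtain ⟨d, hd, hball⟩ := Metric.isOpen_iff.mp isClosed_ofReal_Ici.isOpen_compl z hz
  refine ⟨(1 + ‖z‖) / d + 1, by positivity, fun ξ => ?_⟩
  by_cases hξ : ξ ∈ Set.Ici (0 : ℝ)
  · rw [resolventSymbol, Set.indicator_of_mem hξ]
    have hξ0 : 0 ≤ ξ := hξ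
    set w : ℝ := ‖z - ((2 * Real.pi * ξ : ℝ) : ℂ)‖ with hw
    have h1 : d ≤ w := by
      by_contra hlt
      push Not at hlt
      refine hball (a := ((2 * Real.pi * ξ : ℝ) : ℂ)) ?_ ⟨_, ?_, rfl⟩
      · rw [Metric.mem_ball, dist_comm, dist_eq_norm]
        exact hlt
      · exact mul_nonneg Real.two_pi_pos.le hξ0
    have h2 : 2 * Real.pi * ξ - ‖z‖ ≤ w := by
      have := norm_sub_norm_le (((2 * Real.pi * ξ : ℝ) : ℂ)) z
      rw [Complex.norm_real, Real.norm_of_nonneg (mul_nonneg Real.two_pi_pos.le hξ0),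
        norm_sub_rev] at this
      exact this
    have h3 : ξ ≤ 2 * Real.pi * ξ := by nlinarith [Real.pi_gt_three]
    have hw0 : 0 < w := hd.trans_le h1
    rw [norm_inv, abs_of_nonneg hξ0, ← hw, inv_mul_le_iff₀ hw0]
    have h4 : (1 + ‖z‖) / d * d = 1 + ‖z‖ := by field_simp
    have h5 : (1 + ‖z‖) / d * d ≤ (1 + ‖z‖) / d * w := by gcongr
    nlinarith
  · rw [resolventSymbol, Set.indicator_of_notMem hξ, norm_zero, zero_mul]
    positivity

theorem memLp_top_resolventSymbol {z : ℂ} (hz : z ∉ Complex.ofReal '' Set.Ici (0 : ℝ)) :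
    MemLp (resolventSymbol z) ⊤ volume := by
  obtain ⟨c, hc, h⟩ := exists_norm_resolventSymbol_le hz
  refine memLp_top_of_bound (measurable_resolventSymbol z).aestronglyMeasurable c ?_
  filter_upwards with ξ
  nlinarith [h ξ, abs_nonneg ξ, norm_nonneg (resolventSymbol z ξ)]

theorem memLp_two_resolventSymbol {z : ℂ} (hz : z ∉ Complex.ofReal '' Set.Ici (0 : ℝ)) :
    MemLp (resolventSymbol z) 2 volume := by
  obtain ⟨c, hc, h⟩ := exists_norm_resolventSymbol_le hz
  have hm := (measurable_resolventSymbol z).aestronglyMeasurable (μ := volume)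
  rw [← memLp_norm_iff hm, memLp_two_iff_integrable_sq hm.norm]
  refine (integrable_inv_one_add_sq.const_mul (c ^ 2)).mono' (hm.norm.pow 2) ?_
  filter_upwards with ξ
  have h1 : ‖resolventSymbol z ξ‖ ^ 2 * (1 + ξ ^ 2) ≤ c ^ 2 := by
    calc ‖resolventSymbol z ξ‖ ^ 2 * (1 + ξ ^ 2)
        ≤ ‖resolventSymbol z ξ‖ ^ 2 * (1 + |ξ|) ^ 2 := by
          gcongr
          nlinarith [abs_nonneg ξ, sq_abs ξ]
      _ = (‖resolventSymbol z ξ‖ * (1 + |ξ|)) ^ 2 := by ring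
      _ ≤ c ^ 2 := pow_le_pow_left₀ (by positivity) (h ξ) 2
  rw [Real.norm_of_nonneg (by positivity), ← div_eq_mul_inv, le_div_iff₀ (by positivity)]
  exact h1

theorem sub_mul_resolventSymbol {z : ℂ} (hz : z ∉ Complex.ofReal '' Set.Ici (0 : ℝ)) {ξ : ℝ}
    (hξ : 0 ≤ ξ) : (z - ((2 * Real.pi * ξ : ℝ) : ℂ)) * resolventSymbol z ξ = 1 := by
  rw [resolventSymbol, Set.indicator_of_mem (Set.mem_Ici.mpr hξ)]
  refine mul_inv_cancel₀ fun h0 => hz ⟨2 * Real.pi * ξ, ?_, ?_⟩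
  · exact mul_nonneg Real.two_pi_pos.le hξ
  · exact (sub_eq_zero.mp h0).symm

theorem fourier_injective {f g : L2}
    (h : ((𝓕 f : L2) : ℝ → ℂ) =ᵐ[volume] ((𝓕 g : L2) : ℝ → ℂ)) : f = g :=
  (Lp.fourierTransformₗᵢ ℝ ℂ).injective (Lp.ext h)

/-- Off `[0, ∞)`, the resolvent of `D` is Fourier multiplication by `resolventSymbol z`. -/
theorem exists_resolvent {z : ℂ} (hz : z ∉ Complex.ofReal '' Set.Ici (0 : ℝ)) :
    ∃ R : hardySpace →L[ℂ] hardySpace,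
      (∀ y, ∃ h : R y ∈ sobolevPlus, z • R y - momentum ⟨R y, h⟩ = y) ∧
      (∀ x : sobolevPlus, R (z • (x : hardySpace) - momentum x) = x) ∧
      ∀ y, ((𝓕 (R y : L2) : L2) : ℝ → ℂ) =ᵐ[volume]
        fun ξ => resolventSymbol z ξ * (𝓕 (y : L2) : L2) ξ := by
  set M : L2 →L[ℂ] L2 := multiplier ((memLp_top_resolventSymbol hz).toLp _) with hM
  have hF (f : L2) : ((𝓕 (M f) : L2) : ℝ → ℂ) =ᵐ[volume]
      fun ξ => resolventSymbol z ξ * (𝓕 f : L2) ξ := by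
    filter_upwards [fourier_multiplier ((memLp_top_resolventSymbol hz).toLp _) f,
      (memLp_top_resolventSymbol hz).coeFn_toLp] with ξ h1 h2
    rw [h1, h2]
  have hmem (f : hardySpace) : M (f : L2) ∈ hardySpace := by
    rw [mem_hardySpace]
    filter_upwards [hF f, mem_hardySpace.mp f.2] with ξ h1 h2 hξ
    rw [h1, h2 hξ, mul_zero]
  obtain ⟨c, hc, hb⟩ := exists_norm_resolventSymbol_le hz
  have hsob (f : hardySpace) : (⟨M (f : L2), hmem f⟩ : hardySpace) ∈ sobolevPlus := by
    refine memSobolev_of_memLp ?_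
    refine MemLp.mono ((Lp.memLp (𝓕 (f : L2) : L2)).const_mul (c : ℂ))
      (Complex.continuous_ofReal.aestronglyMeasurable.mul (Lp.aestronglyMeasurable _)) ?_
    filter_upwards [hF f] with ξ h1
    rw [h1, norm_mul, norm_mul, norm_mul, ← mul_assoc, Complex.norm_real, Complex.norm_real,
      Real.norm_of_nonneg hc]
    gcongr
    have := hb ξ
    rw [Real.norm_eq_abs]
    nlinarith [norm_nonneg (resolventSymbol z ξ)]
  refine ⟨(M ∘L hardySpace.subtypeL).codRestrict hardySpace fun f => hmem f,
    fun y => ⟨hsob y, ?_⟩, fun x => ?_, fun y => hF y⟩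
  · apply Subtype.ext
    apply fourier_injective
    set h : sobolevPlus := ⟨⟨M (y : L2), hmem y⟩, hsob y⟩ with hh
    have e : (((z • (h : hardySpace) - momentum h : hardySpace)) : L2) =
      z • (M (y : L2)) - (momentum h : L2) := rfl
    change ((𝓕 (((z • (h : hardySpace) - momentum h : hardySpace)) : L2) : L2) : ℝ → ℂ)
      =ᵐ[volume] _
    have e2 : (𝓕 (z • (M (y : L2)) - (momentum h : L2)) : L2) =
        z • (𝓕 (M (y : L2)) : L2) - (𝓕 (momentum h : L2) : L2) := by
      exact ((Lp.fourierTransformₗᵢ ℝ ℂ).map_sub _ _).trans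
        (congrArg (· - _) ((Lp.fourierTransformₗᵢ ℝ ℂ).map_smul z _))
    rw [e, e2]
    filter_upwards [Lp.coeFn_sub (z • (𝓕 (M (y : L2)) : L2)) (𝓕 (momentum h : L2) : L2),
      Lp.coeFn_smul z (𝓕 (M (y : L2)) : L2), hF y, fourier_momentum h,
      mem_hardySpace.mp y.2] with ξ h1 h2 h3 h4 h5
    rw [h1, Pi.sub_apply, h2, Pi.smul_apply, h4]
    change z • (𝓕 (M (y : L2)) : L2) ξ - _ * (𝓕 (M (y : L2)) : L2) ξ = _
    rw [h3, smul_eq_mul, ← sub_mul, ← mul_assoc]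
    rcases lt_or_ge ξ 0 with hξ | hξ
    · rw [h5 hξ, mul_zero]
    · rw [sub_mul_resolventSymbol hz hξ, one_mul]
  · apply Subtype.ext
    apply fourier_injective
    change ((𝓕 (M ((z • (x : hardySpace) - momentum x : hardySpace) : L2)) : L2) : ℝ → ℂ)
      =ᵐ[volume] _
    have e : ((z • (x : hardySpace) - momentum x : hardySpace) : L2) =
      z • ((x : hardySpace) : L2) - (momentum x : L2) := rfl
    have e2 : (𝓕 (z • ((x : hardySpace) : L2) - (momentum x : L2)) : L2) =
        z • (𝓕 ((x : hardySpace) : L2) : L2) - (𝓕 (momentum x : L2) : L2) := by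
      exact ((Lp.fourierTransformₗᵢ ℝ ℂ).map_sub _ _).trans
        (congrArg (· - _) ((Lp.fourierTransformₗᵢ ℝ ℂ).map_smul z _))
    filter_upwards [hF ((z • (x : hardySpace) - momentum x : hardySpace) : L2),
      Lp.coeFn_sub (z • (𝓕 ((x : hardySpace) : L2) : L2)) (𝓕 (momentum x : L2) : L2),
      Lp.coeFn_smul z (𝓕 ((x : hardySpace) : L2) : L2), fourier_momentum x,
      mem_hardySpace.mp (x : hardySpace).2] with ξ h1 h2 h3 h4 h5
    rw [h1, e, e2, h2, Pi.sub_apply, h3, Pi.smul_apply, h4, smul_eq_mul, ← sub_mul]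
    rcases lt_or_ge ξ 0 with hξ | hξ
    · rw [h5 hξ, mul_zero, mul_zero]
    · rw [← mul_assoc, mul_comm (resolventSymbol z ξ), sub_mul_resolventSymbol hz hξ, one_mul]

end Fourier

/-! ### Relative compactness of the Toeplitz operator -/

section Compact

open Filter Topology

variable {F : Type*} [NormedAddCommGroup F] [NormedSpace ℂ F]

/-- The Hilbert–Schmidt operator `y ↦ (x ↦ Φ x y)` with values in `L²`, whose kernel is a square
integrable family `Φ` of continuous linear functionals. -/
noncomputable def kernelOperator (Φ : Lp (StrongDual ℂ F) 2 (volume : Measure ℝ)) : F →L[ℂ] L2 :=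
  ((ContinuousLinearMap.apply ℂ ℂ : F →L[ℂ] StrongDual ℂ F →L[ℂ] ℂ).compLpL₂ 2 volume).flip Φ

theorem kernelOperator_coeFn (Φ : Lp (StrongDual ℂ F) 2 (volume : Measure ℝ)) (y : F) :
    (kernelOperator Φ y : ℝ → ℂ) =ᵐ[volume] fun x => Φ x y :=
  ContinuousLinearMap.coeFn_compLp' (ContinuousLinearMap.apply ℂ ℂ y) Φ

/-- The kernel is a limit of simple functions, whose kernel operators have finite rank. -/
theorem isCompactOperator_kernelOperator (Φ : Lp (StrongDual ℂ F) 2 (volume : Measure ℝ)) :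
    IsCompactOperator (kernelOperator Φ) := by
  refine Lp.induction (by norm_num) (motive := fun Φ => IsCompactOperator (kernelOperator Φ))
    ?_ ?_ ?_ Φ
  · intro c s hs hμs
    have h : kernelOperator (Lp.simpleFunc.indicatorConst 2 hs hμs.ne c : Lp _ 2 volume) =
        (ContinuousLinearMap.toSpanSingleton ℂ
          (indicatorConstLp 2 hs hμs.ne (1 : ℂ) : L2)) ∘L c := by
      ext1 y
      ext1
      filter_upwards [kernelOperator_coeFn
          (Lp.simpleFunc.indicatorConst 2 hs hμs.ne c : Lp _ 2 volume) y,
        indicatorConstLp_coeFn (p := 2) (hs := hs) (hμs := hμs.ne) (c := c),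
        indicatorConstLp_coeFn (p := 2) (hs := hs) (hμs := hμs.ne) (c := (1 : ℂ)),
        Lp.coeFn_smul (c y) (indicatorConstLp 2 hs hμs.ne (1 : ℂ) : L2)] with x h1 h2 h3 h4
      rw [h1, Lp.simpleFunc.coe_indicatorConst, h2]
      change _ = (c y • (indicatorConstLp 2 hs hμs.ne (1 : ℂ) : L2)) x
      rw [h4, Pi.smul_apply, h3]
      by_cases hx : x ∈ s <;> simp [hx]
    rw [h]
    have hc : IsCompactOperator c := isCompactOperator_of_locallyCompactSpace_dom c
    exact hc.clm_comp (ContinuousLinearMap.toSpanSingleton ℂ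
      (indicatorConstLp 2 hs hμs.ne (1 : ℂ) : L2))
  · intro f g hf hg _ h1 h2
    have : kernelOperator (hf.toLp f + hg.toLp g) =
        kernelOperator (hf.toLp f) + kernelOperator (hg.toLp g) := by
      rw [kernelOperator, map_add]; rfl
    rw [this]
    exact h1.add h2
  · exact isClosed_setOfPred_isCompactOperator.preimage
      ((ContinuousLinearMap.apply ℂ ℂ : F →L[ℂ] StrongDual ℂ F →L[ℂ] ℂ).compLpL₂
        2 volume).flip.continuous

theorem norm_sq_eq_integral (f : L2) : ‖f‖ ^ 2 = ∫ x, ‖f x‖ ^ 2 := by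
  have h := congrArg Complex.re (L2.inner_def (𝕜 := ℂ) f f)
  rw [inner_self_eq_norm_sq_to_K] at h
  simp only [inner_self_eq_norm_sq_to_K] at h
  exact_mod_cast h

theorem memLp_smul_of_bounded {v : ℝ → ℂ} (hv : MemLp v 2 volume) {φ : ℝ → F}
    (hφ : Continuous φ) {C : ℝ} (hC : ∀ x, ‖φ x‖ ≤ C) :
    MemLp (fun x => v x • φ x) 2 volume := by
  have hC0 : 0 ≤ C := (norm_nonneg _).trans (hC 0)
  refine MemLp.mono (hv.mul_const (C : ℂ)) (hv.1.smul hφ.aestronglyMeasurable) ?_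
  filter_upwards with x
  rw [norm_smul, norm_mul, Complex.norm_real, Real.norm_of_nonneg hC0]
  gcongr
  exact hC x

theorem memLp_modulate {m : ℝ → ℂ} (hm : MemLp m 2 volume) (x : ℝ) :
    MemLp (fun ξ => (Real.fourierChar (ξ * x) : ℂ) * m ξ) 2 volume := by
  refine hm.mono ?_ ?_
  · have : Continuous fun ξ : ℝ => (Real.fourierChar (ξ * x) : ℂ) := by fun_prop
    exact this.aestronglyMeasurable.mul hm.1
  · filter_upwards with ξ
    rw [norm_mul, Circle.norm_coe, one_mul]

/-- The modulation `ξ ↦ exp (2 π i x ξ) m ξ` of a function in `L²`. -/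
noncomputable def modulate {m : ℝ → ℂ} (hm : MemLp m 2 volume) (x : ℝ) : L2 :=
  (memLp_modulate hm x).toLp _

theorem norm_modulate_le {m : ℝ → ℂ} (hm : MemLp m 2 volume) (x : ℝ) :
    ‖modulate hm x‖ ≤ ‖hm.toLp m‖ := by
  refine Lp.norm_le_norm_of_ae_le ?_
  filter_upwards [(memLp_modulate hm x).coeFn_toLp, hm.coeFn_toLp] with ξ h1 h2
  rw [modulate, h1, h2, norm_mul, Circle.norm_coe, one_mul]

theorem continuous_modulate {m : ℝ → ℂ} (hm : MemLp m 2 volume) : Continuous (modulate hm) := by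
  rw [continuous_iff_continuousAt]
  intro a
  rw [ContinuousAt, tendsto_iff_norm_sub_tendsto_zero]
  have key (x : ℝ) : ‖modulate hm x - modulate hm a‖ ^ 2 =
      ∫ ξ, ‖((Real.fourierChar (ξ * x) : ℂ) - Real.fourierChar (ξ * a)) * m ξ‖ ^ 2 := by
    rw [norm_sq_eq_integral]
    apply integral_congr_ae
    filter_upwards [Lp.coeFn_sub (modulate hm x) (modulate hm a),
      (memLp_modulate hm x).coeFn_toLp, (memLp_modulate hm a).coeFn_toLp] with ξ h1 h2 h3
    rw [h1, Pi.sub_apply, modulate, modulate, h2, h3, sub_mul]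
  have hlim : Tendsto (fun x => ‖modulate hm x - modulate hm a‖ ^ 2) (𝓝 a) (𝓝 0) := by
    simp only [key]
    have h0 :
        ∫ ξ, ‖((Real.fourierChar (ξ * a) : ℂ) - Real.fourierChar (ξ * a)) * m ξ‖ ^ 2 = 0 := by
      simp
    rw [← h0]
    have hint := hm.integrable_norm_pow (by norm_num)
    refine tendsto_integral_filter_of_dominated_convergence (fun ξ => 4 * ‖m ξ‖ ^ 2) ?_ ?_ ?_ ?_
    · refine Eventually.of_forall fun x => ?_
      have h1 : Continuous fun ξ : ℝ =>
          (Real.fourierChar (ξ * x) : ℂ) - Real.fourierChar (ξ * a) := by fun_prop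
      exact (h1.aestronglyMeasurable.mul hm.1).norm.pow 2
    · refine Eventually.of_forall fun x => Eventually.of_forall fun ξ => ?_
      rw [Real.norm_of_nonneg (by positivity), norm_mul, mul_pow]
      gcongr
      have h1 : ‖(Real.fourierChar (ξ * x) : ℂ) - Real.fourierChar (ξ * a)‖ ≤ 2 := by
        refine (norm_sub_le _ _).trans ?_
        rw [Circle.norm_coe, Circle.norm_coe]
        norm_num
      nlinarith [norm_nonneg ((Real.fourierChar (ξ * x) : ℂ) - Real.fourierChar (ξ * a))]
    · exact (by simpa using hint : Integrable fun ξ => ‖m ξ‖ ^ 2).const_mul 4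
    · refine Eventually.of_forall fun ξ => Continuous.tendsto ?_ a
      fun_prop
  have h2 := hlim.sqrt
  simpa [Real.sqrt_sq (norm_nonneg _)] using h2

/-- The integral pairing `(k, f) ↦ ∫ k f` on `L²`. -/
noncomputable def pairing : L2 →L[ℂ] StrongDual ℂ L2 :=
  (ContinuousLinearMap.mul ℂ ℂ).lpPairing volume 2 2

/-- The Szegő projector as a continuous linear map. -/
noncomputable def szegoL : L2 →L[ℂ] hardySpace :=
  szego.mkContinuous 1 fun f => by simpa using norm_szego_le f

/-- Off `[0, ∞)`, the Toeplitz operator `T_u` is relatively compact with respect to `D`. As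
`(z - D)⁻¹ y (x) = ∫ exp (2 π i x ξ) (z - 2 π ξ)⁻¹ ŷ(ξ) dξ` and `u` and the symbol of the resolvent
are both square integrable, `y ↦ u (z - D)⁻¹ y` is a Hilbert–Schmidt operator. -/
theorem relCompactAt_toeplitzMap (u : Lp ℝ 2 (volume : Measure ℝ)) {z : ℂ}
    (hz : z ∉ Complex.ofReal '' Set.Ici (0 : ℝ)) : RelCompactAt momentum (toeplitzMap u) z := by
  obtain ⟨R, hR, hL, hF⟩ := exists_resolvent hz
  set m := resolventSymbol z
  have hm : MemLp m 2 volume := memLp_two_resolventSymbol hz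
  set T : hardySpace →L[ℂ] L2 :=
    (Lp.fourierTransformₗᵢ ℝ ℂ).toContinuousLinearEquiv.toContinuousLinearMap ∘L
      hardySpace.subtypeL with hT
  set φ : ℝ → StrongDual ℂ hardySpace := fun x => (pairing (modulate hm x)) ∘L T with hφ
  have hφc : Continuous φ :=
    (pairing.continuous.comp (continuous_modulate hm)).clm_comp continuous_const
  have hφb (x : ℝ) : ‖φ x‖ ≤ ‖pairing‖ * ‖hm.toLp m‖ * ‖T‖ := by
    refine (ContinuousLinearMap.opNorm_comp_le _ _).trans ?_
    gcongr
    exact (pairing.le_opNorm _).trans (by gcongr; exact norm_modulate_le hm x)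
  have hu : MemLp (fun x => (u x : ℂ)) 2 volume := (Lp.memLp u).ofReal
  have hΦ := memLp_smul_of_bounded (F := StrongDual ℂ hardySpace) hu hφc hφb
  have hφy (x : ℝ) (y : hardySpace) (hx : ((R y : hardySpace) : L2) x =
      𝓕⁻ ((𝓕 (R y : L2) : L2) : ℝ → ℂ) x) : φ x y = (R y : L2) x := by
    rw [hx, Real.fourierInv_eq]
    change pairing (modulate hm x) (𝓕 (y : L2)) = _
    rw [pairing, ContinuousLinearMap.lpPairing_eq_integral]
    apply integral_congr_ae
    filter_upwards [(memLp_modulate hm x).coeFn_toLp, hF y] with ξ h1 h2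
    rw [modulate, h1, h2]
    simp only [ContinuousLinearMap.mul_apply', Circle.smul_def, smul_eq_mul]
    rw [mul_assoc]
    congr 3
    simp [mul_comm]
  refine ⟨R, szegoL ∘L kernelOperator (hΦ.toLp _), fun y => ?_, hL, ?_⟩
  · obtain ⟨hmem, h1⟩ := hR y
    refine ⟨hmem, h1, ?_⟩
    change szego (mulBy u ⟨R y, hmem⟩) = szego (kernelOperator (hΦ.toLp _) y)
    congr 1
    ext1
    filter_upwards [(memLp_mul u ⟨R y, hmem⟩).coeFn_toLp, kernelOperator_coeFn (hΦ.toLp _) y,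
      hΦ.coeFn_toLp, ae_eq_fourierInv ⟨R y, hmem⟩] with x h1 h2 h3 h4
    rw [h2, h3]
    change ((memLp_mul u ⟨R y, hmem⟩).toLp _ : L2) x = (u x : ℂ) • φ x y
    rw [h1, hφy x y h4, smul_eq_mul]
  · exact (isCompactOperator_kernelOperator _).clm_comp szegoL

end Compact

/-! ### The Sobolev inequality on the Hardy space -/

section Sobolev

open Convolution ENNReal

/-- The density `(t (ξ - t))^{-1/2}` on `(0, ξ)`. -/
noncomputable def arcsineWeight (ξ t : ℝ) : ℝ≥0∞ :=
  (Set.Ioo 0 ξ).indicator (fun t => ENNReal.ofReal (√t * √(ξ - t))⁻¹) t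

theorem measurable_arcsineWeight (ξ : ℝ) : Measurable (arcsineWeight ξ) :=
  Measurable.indicator (by fun_prop) measurableSet_Ioo

/-- The total mass is the Beta integral `B(1/2, 1/2) = π`, whatever `ξ > 0` is. -/
theorem lintegral_arcsineWeight {ξ : ℝ} (hξ : 0 < ξ) :
    ∫⁻ t, arcsineWeight ξ t = ENNReal.ofReal Real.pi := by
  have hbeta : ProbabilityTheory.beta (1 / 2) (1 / 2) = Real.pi := by
    rw [ProbabilityTheory.beta, Real.Gamma_one_half_eq, Real.mul_self_sqrt Real.pi_pos.le]
    norm_num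
  have h1 : ∀ t, arcsineWeight ξ t = ENNReal.ofReal Real.pi *
      (ENNReal.ofReal ξ⁻¹ * ProbabilityTheory.betaPDF (1 / 2) (1 / 2) (ξ⁻¹ * t)) := by
    intro t
    rw [arcsineWeight, ProbabilityTheory.betaPDF, ProbabilityTheory.betaPDFReal, hbeta]
    by_cases ht : t ∈ Set.Ioo 0 ξ
    · have h0 : 0 < ξ⁻¹ * t := mul_pos (inv_pos.mpr hξ) ht.1
      have h1 : ξ⁻¹ * t < 1 := by
        rw [inv_mul_lt_iff₀ hξ, mul_one]
        exact ht.2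
      have h2 : 0 < ξ - t := sub_pos.mpr ht.2
      rw [Set.indicator_of_mem ht, if_pos ⟨h0, h1⟩,
        ← ENNReal.ofReal_mul (inv_nonneg.mpr hξ.le), ← ENNReal.ofReal_mul Real.pi_pos.le]
      congr 1
      have e1 : 1 - ξ⁻¹ * t = ξ⁻¹ * (ξ - t) := by field_simp
      have e2 : (1 / 2 : ℝ) - 1 = -(1 / 2) := by norm_num
      rw [e1, e2, Real.rpow_neg h0.le, Real.rpow_neg (by positivity), ← Real.sqrt_eq_rpow,
        ← Real.sqrt_eq_rpow, Real.sqrt_mul (by positivity), Real.sqrt_mul (by positivity),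
        Real.sqrt_inv]
      have h3 : √ξ * √ξ = ξ := Real.mul_self_sqrt hξ.le
      have := Real.sqrt_pos.mpr hξ
      have := Real.sqrt_pos.mpr ht.1
      have := Real.sqrt_pos.mpr h2
      have := Real.pi_pos
      field_simp
      nlinarith
    · rw [Set.indicator_of_notMem ht, if_neg, ENNReal.ofReal_zero, mul_zero, mul_zero]
      rintro ⟨h0, h1⟩
      refine ht ⟨?_, ?_⟩
      · exact pos_of_mul_pos_right h0 (inv_nonneg.mpr hξ.le)
      · rwa [inv_mul_lt_iff₀ hξ, mul_one] at h1
  have hm : Measurable (ProbabilityTheory.betaPDF (1 / 2) (1 / 2)) :=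
    (ProbabilityTheory.measurable_betaPDFReal _ _).ennreal_ofReal
  simp only [h1]
  rw [lintegral_const_mul' _ _ ENNReal.ofReal_ne_top,
    lintegral_const_mul' _ _ ENNReal.ofReal_ne_top,
    ← lintegral_map (f := ProbabilityTheory.betaPDF (1 / 2) (1 / 2)) (g := fun t => ξ⁻¹ * t) hm
      (by fun_prop),
    Real.map_volume_mul_left (inv_ne_zero hξ.ne'), lintegral_smul_measure,
    ProbabilityTheory.lintegral_betaPDF_eq_one (by norm_num) (by norm_num), inv_inv,
    abs_of_pos hξ, smul_eq_mul, mul_one, ← ENNReal.ofReal_mul (inv_nonneg.mpr hξ.le),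
    inv_mul_cancel₀ hξ.ne', ENNReal.ofReal_one, mul_one]

/-- The Cauchy–Schwarz inequality for the convolution square of a function on `(0, ∞)`, with the
weight `(t (ξ - t))^{1/2}`. -/
theorem sq_lintegral_convolution_le {g : ℝ → ℂ} (hg : Measurable g) (hg0 : ∀ t ≤ 0, g t = 0)
    (ξ : ℝ) :
    (∫⁻ t, ‖g t‖ₑ * ‖g (ξ - t)‖ₑ) ^ 2 ≤ ENNReal.ofReal Real.pi *
      ∫⁻ t, (ENNReal.ofReal √t * ‖g t‖ₑ ^ 2) * (ENNReal.ofReal √(ξ - t) * ‖g (ξ - t)‖ₑ ^ 2) := by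
  set H : ℝ → ℝ≥0∞ := fun t =>
    (ENNReal.ofReal √t * ‖g t‖ₑ ^ 2) * (ENNReal.ofReal √(ξ - t) * ‖g (ξ - t)‖ₑ ^ 2) with hH
  have hzero : ∀ t, t ∉ Set.Ioo 0 ξ → ‖g t‖ₑ * ‖g (ξ - t)‖ₑ = 0 := by
    intro t ht
    rcases le_or_gt t 0 with h | h
    · rw [hg0 t h, enorm_zero, zero_mul]
    · have : ξ - t ≤ 0 := by
        by_contra h'
        exact ht ⟨h, by linarith⟩
      rw [hg0 _ this, enorm_zero, mul_zero]
  rcases le_or_gt ξ 0 with hξ | hξ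
  · have : ∀ t, ‖g t‖ₑ * ‖g (ξ - t)‖ₑ = 0 := fun t => hzero t fun h => by
      have := h.1.trans h.2
      linarith
    simp [this]
  have hpt : ∀ t, ‖g t‖ₑ * ‖g (ξ - t)‖ₑ = arcsineWeight ξ t ^ (1 / 2 : ℝ) * H t ^ (1 / 2 : ℝ) := by
    intro t
    by_cases ht : t ∈ Set.Ioo 0 ξ
    · rw [arcsineWeight, Set.indicator_of_mem ht,
        ← ENNReal.mul_rpow_of_nonneg _ _ (by norm_num : (0 : ℝ) ≤ 1 / 2)]
      have h1 := Real.sqrt_pos.mpr ht.1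
      have h2 := Real.sqrt_pos.mpr (sub_pos.mpr ht.2)
      have h3 : ENNReal.ofReal (√t * √(ξ - t))⁻¹ * H t = (‖g t‖ₑ * ‖g (ξ - t)‖ₑ) ^ 2 := by
        have h4 : ENNReal.ofReal (√t * √(ξ - t))⁻¹ *
            (ENNReal.ofReal √t * ENNReal.ofReal √(ξ - t)) = 1 := by
          rw [← ENNReal.ofReal_mul h1.le, ← ENNReal.ofReal_mul (by positivity),
            inv_mul_cancel₀ (by positivity), ENNReal.ofReal_one]
        calc _ = (ENNReal.ofReal (√t * √(ξ - t))⁻¹ *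
            (ENNReal.ofReal √t * ENNReal.ofReal √(ξ - t))) * (‖g t‖ₑ * ‖g (ξ - t)‖ₑ) ^ 2 := by
              rw [hH]; ring
          _ = _ := by rw [h4, one_mul]
      rw [h3, ← ENNReal.rpow_natCast, ← ENNReal.rpow_mul]
      norm_num
    · rw [hzero t ht, arcsineWeight, Set.indicator_of_notMem ht,
        ENNReal.zero_rpow_of_pos (by norm_num), zero_mul]
  have hHm : Measurable H := by fun_prop
  have hcs := ENNReal.lintegral_mul_norm_pow_le (measurable_arcsineWeight ξ).aemeasurable
    hHm.aemeasurable (μ := volume) (p := 1 / 2) (q := 1 / 2) (by norm_num) (by norm_num)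
    (by norm_num)
  rw [lintegral_arcsineWeight hξ] at hcs
  simp only [hpt]
  calc _ ≤ (ENNReal.ofReal Real.pi ^ (1 / 2 : ℝ) * (∫⁻ t, H t) ^ (1 / 2 : ℝ)) ^ 2 := by gcongr
    _ = _ := by
      rw [mul_pow, ← ENNReal.rpow_natCast, ← ENNReal.rpow_natCast, ← ENNReal.rpow_mul,
        ← ENNReal.rpow_mul]
      norm_num

theorem lintegral_sq_convolution_le {g : ℝ → ℂ} (hg : Measurable g) (hg0 : ∀ t ≤ 0, g t = 0) :
    ∫⁻ ξ, ‖(g ⋆[ContinuousLinearMap.mul ℂ ℂ] g) ξ‖ₑ ^ 2 ≤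
      ENNReal.ofReal Real.pi * (∫⁻ t, ENNReal.ofReal √t * ‖g t‖ₑ ^ 2) ^ 2 := by
  set F : ℝ → ℝ≥0∞ := fun t => ENNReal.ofReal √t * ‖g t‖ₑ ^ 2 with hF
  have hFm : Measurable F := by fun_prop
  have h1 : ∀ ξ, ‖(g ⋆[ContinuousLinearMap.mul ℂ ℂ] g) ξ‖ₑ ^ 2 ≤
      ENNReal.ofReal Real.pi * ∫⁻ t, F t * F (ξ - t) := by
    intro ξ
    refine le_trans ?_ (sq_lintegral_convolution_le hg hg0 ξ)
    gcongr
    rw [convolution_def]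
    refine (enorm_integral_le_lintegral_enorm _).trans_eq ?_
    simp only [ContinuousLinearMap.mul_apply', enorm_mul]
  calc _ ≤ ∫⁻ ξ, ENNReal.ofReal Real.pi * ∫⁻ t, F t * F (ξ - t) := lintegral_mono h1
    _ = ENNReal.ofReal Real.pi * ∫⁻ ξ, ∫⁻ t, F t * F (ξ - t) :=
      lintegral_const_mul' _ _ ENNReal.ofReal_ne_top
    _ = ENNReal.ofReal Real.pi * ∫⁻ t, ∫⁻ ξ, F t * F (ξ - t) := by
      rw [lintegral_lintegral_swap]
      exact Measurable.aemeasurable (by fun_prop)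
    _ = _ := by
      congr 1
      have h2 : ∀ t, ∫⁻ ξ, F t * F (ξ - t) = F t * ∫⁻ ξ, F ξ := by
        intro t
        rw [lintegral_const_mul _ (by fun_prop), lintegral_sub_right_eq_self]
      simp only [h2]
      rw [lintegral_mul_const _ hFm, sq]

theorem eLpNorm_two_sq (f : ℝ → ℂ) : eLpNorm f 2 volume ^ 2 = ∫⁻ x, ‖f x‖ₑ ^ 2 := by
  have := eLpNorm_nnreal_pow_eq_lintegral (f := f) (μ := (volume : Measure ℝ)) (p := 2)
    (by norm_num)
  simpa using this

/-- The function whose `L²` norm is `‖ |D|^{1/4} f ‖`. -/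
noncomputable def quarterDeriv (f : L2) : ℝ → ℂ :=
  fun ξ => (((2 * Real.pi * |ξ|) ^ (1 / 4 : ℝ) : ℝ) : ℂ) * (𝓕 f : L2) ξ

theorem aestronglyMeasurable_quarterDeriv (f : L2) :
    AEStronglyMeasurable (quarterDeriv f) volume :=
  Measurable.aestronglyMeasurable (by fun_prop) |>.mul (Lp.aestronglyMeasurable _)

theorem norm_sq_quarterDeriv (f : L2) (ξ : ℝ) :
    ‖quarterDeriv f ξ‖ ^ 2 = √(2 * Real.pi * |ξ|) * ‖(𝓕 f : L2) ξ‖ ^ 2 := by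
  have h0 : 0 ≤ 2 * Real.pi * |ξ| := mul_nonneg Real.two_pi_pos.le (abs_nonneg _)
  rw [quarterDeriv, norm_mul, mul_pow, Complex.norm_real, Real.norm_of_nonneg (by positivity),
    Real.sqrt_eq_rpow, ← Real.rpow_natCast, ← Real.rpow_mul h0]
  norm_num

theorem memLp_quarterDeriv (h : sobolevPlus) :
    MemLp (quarterDeriv ((h : hardySpace) : L2)) 2 volume := by
  set f : L2 := ((h : hardySpace) : L2)
  have hm := aestronglyMeasurable_quarterDeriv f
  refine MemLp.mono' ((Lp.memLp (𝓕 f : L2)).norm.add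
    (((memLp_fourier_mul h).norm).const_mul (2 * Real.pi))) hm ?_
  filter_upwards with ξ
  have h0 : 0 ≤ 2 * Real.pi * |ξ| := mul_nonneg Real.two_pi_pos.le (abs_nonneg _)
  have h1 : (2 * Real.pi * |ξ|) ^ (1 / 4 : ℝ) ≤ 1 + 2 * Real.pi * |ξ| := by
    calc (2 * Real.pi * |ξ|) ^ (1 / 4 : ℝ) ≤ (1 + 2 * Real.pi * |ξ|) ^ (1 / 4 : ℝ) := by
          gcongr
          linarith
      _ ≤ (1 + 2 * Real.pi * |ξ|) ^ (1 : ℝ) :=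
          Real.rpow_le_rpow_of_exponent_le (by linarith) (by norm_num)
      _ = _ := Real.rpow_one _
  rw [quarterDeriv, norm_mul, Pi.add_apply, norm_mul, Complex.norm_real, Complex.norm_real,
    Real.norm_of_nonneg (by positivity), Real.norm_eq_abs]
  nlinarith [norm_nonneg ((𝓕 f : L2) ξ)]

/-- The Sobolev inequality `‖h‖_{L⁴} ≤ ‖ |D|^{1/4} h ‖_{L²}` on `H¹₊`. By Plancherel,
`‖h‖_{L⁴}² = ‖h²‖_{L²} = ‖ĥ ⋆ ĥ‖_{L²}`, and the Beta integral bounds the fourth powers with the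
constant `π / (2 π)`, which is at most `1`. -/
theorem eLpNorm_four_le (h : sobolevPlus) :
    eLpNorm (((h : hardySpace) : L2) : ℝ → ℂ) 4 volume ≤
      eLpNorm (quarterDeriv ((h : hardySpace) : L2)) 2 volume := by
  set f : L2 := ((h : hardySpace) : L2) with hf
  set fh : L2 := 𝓕 f with hfh
  set g : ℝ → ℂ := (Set.Ioi (0 : ℝ)).indicator fh with hg
  have hgm : Measurable g :=
    Measurable.indicator (Lp.stronglyMeasurable fh).measurable measurableSet_Ioi
  have hg0 : ∀ t ≤ 0, g t = 0 := fun t ht => Set.indicator_of_notMem (by simpa using ht) _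
  have hgf : (fh : ℝ → ℂ) =ᵐ[volume] g := by
    have hne : ∀ᵐ t : ℝ, t ≠ 0 := by simp [ae_iff]
    filter_upwards [mem_hardySpace.mp (h : hardySpace).2, hne] with t h1 h2
    rcases lt_or_gt_of_ne h2 with ht | ht
    · rw [hg0 t ht.le]
      exact h1 ht
    · rw [hg, Set.indicator_of_mem (Set.mem_Ioi.mpr ht)]
  have hgi : Integrable g := (integrable_fourier h).congr hgf
  set G := g ⋆[ContinuousLinearMap.mul ℂ ℂ] g with hG
  have hGi : Integrable G := hgi.integrable_convolution (ContinuousLinearMap.mul ℂ ℂ) hgi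
  -- the right-hand side, in terms of `g`
  have hW : eLpNorm (quarterDeriv f) 2 volume ^ 2 =
      ENNReal.ofReal √(2 * Real.pi) * ∫⁻ t, ENNReal.ofReal √t * ‖g t‖ₑ ^ 2 := by
    rw [eLpNorm_two_sq, ← lintegral_const_mul' _ _ ENNReal.ofReal_ne_top]
    apply lintegral_congr_ae
    filter_upwards [hgf] with t ht
    have e : ‖quarterDeriv f t‖ₑ ^ 2 = ENNReal.ofReal (‖quarterDeriv f t‖ ^ 2) := by
      rw [ENNReal.ofReal_pow (norm_nonneg _), ofReal_norm]
    rw [e, norm_sq_quarterDeriv, ← hfh, ht]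
    rcases le_or_gt t 0 with h0 | h0
    · rw [hg0 t h0]
      simp
    · rw [abs_of_pos h0, Real.sqrt_mul Real.two_pi_pos.le, mul_assoc,
        ENNReal.ofReal_mul (by positivity), ENNReal.ofReal_mul (by positivity),
        ENNReal.ofReal_pow (norm_nonneg _), ofReal_norm]
  have hbound : eLpNorm G 2 volume ^ 2 ≤ eLpNorm (quarterDeriv f) 2 volume ^ 4 := by
    rw [eLpNorm_two_sq]
    refine (lintegral_sq_convolution_le hgm hg0).trans ?_
    have e : eLpNorm (quarterDeriv f) 2 volume ^ 4 =
        (eLpNorm (quarterDeriv f) 2 volume ^ 2) ^ 2 := by ring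
    rw [e, hW, mul_pow, ← ENNReal.ofReal_pow (Real.sqrt_nonneg _),
      Real.sq_sqrt Real.two_pi_pos.le]
    gcongr
    linarith [Real.pi_pos]
  have hGle : eLpNorm G 2 volume ≤ eLpNorm (quarterDeriv f) 2 volume ^ 2 := by
    refine (ENNReal.pow_le_pow_left_iff two_ne_zero).mp ?_
    rw [← pow_mul]
    exact hbound
  have hG2 : MemLp G 2 volume :=
    ⟨hGi.1, hGle.trans_lt (ENNReal.pow_lt_top (memLp_quarterDeriv h).2)⟩
  -- Plancherel for `h²`, the inverse Fourier transform of `G`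
  have hsq : (fun x => f x ^ 2) =ᵐ[volume] (𝓕⁻ (hG2.toLp G) : L2) := by
    have h1 := fourierInv_ae_eq (g := hG2.toLp G) (hGi.congr hG2.coeFn_toLp.symm)
    have h2 : 𝓕⁻ ((hG2.toLp G : L2) : ℝ → ℂ) = 𝓕⁻ G := by
      ext x
      rw [Real.fourierInv_eq, Real.fourierInv_eq]
      apply integral_congr_ae
      filter_upwards [hG2.coeFn_toLp] with ξ hξ
      rw [hξ]
    have h3 : 𝓕⁻ (fh : ℝ → ℂ) = 𝓕⁻ g := by
      ext x
      rw [Real.fourierInv_eq, Real.fourierInv_eq]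
      apply integral_congr_ae
      filter_upwards [hgf] with ξ hξ
      rw [hξ]
    filter_upwards [h1, ae_eq_fourierInv h] with x h4 h5
    rw [h4, h2, Real.fourierInv_eq_fourier_neg, hG, Real.fourier_mul_convolution_eq hgi hgi,
      ← Real.fourierInv_eq_fourier_neg, ← h3, ← sq]
    rw [← hf, ← hfh] at h5
    rw [h5]
  have hPl : eLpNorm (fun x => f x ^ 2) 2 volume = eLpNorm G 2 volume := by
    have h1 : ‖(𝓕⁻ (hG2.toLp G) : L2)‖ = ‖hG2.toLp G‖ := by
      rw [← Lp.norm_fourier_eq, fourier_fourierInv_eq]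
    rw [eLpNorm_congr_ae hsq, ← eLpNorm_congr_ae hG2.coeFn_toLp]
    rw [Lp.norm_def, Lp.norm_def] at h1
    exact (ENNReal.toReal_eq_toReal_iff' (Lp.eLpNorm_ne_top _) (Lp.eLpNorm_ne_top _)).mp h1
  have h4 : eLpNorm (f : ℝ → ℂ) 4 volume ^ 2 = eLpNorm (fun x => f x ^ 2) 2 volume := by
    have h5 := eLpNorm_norm_rpow (p := 2) (μ := (volume : Measure ℝ)) (f : ℝ → ℂ)
      (q := 2) (by norm_num)
    have h6 : eLpNorm (fun x => f x ^ 2) 2 volume =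
        eLpNorm (fun x => ‖f x‖ ^ (2 : ℝ)) 2 volume := by
      rw [← eLpNorm_norm]
      simp
    rw [h6, h5, ← ENNReal.rpow_natCast]
    norm_num
  refine (ENNReal.pow_le_pow_left_iff two_ne_zero).mp ?_
  rw [h4, hPl]
  exact hGle

end Sobolev

/-! ### The quadratic form of `L_u` -/

section Form

theorem absDNorm_sq (h : sobolevPlus) :
    absDNorm (1 / 4) (h : hardySpace) ^ 2 =
      ∫ ξ : ℝ, √(2 * Real.pi * |ξ|) * ‖(𝓕 ((h : hardySpace) : L2) : L2) ξ‖ ^ 2 := by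
  have hm := memLp_quarterDeriv h
  have e : absDNorm (1 / 4) (h : hardySpace) = ‖hm.toLp _‖ := (Lp.norm_toLp _ hm).symm
  rw [e, norm_sq_eq_integral]
  apply integral_congr_ae
  filter_upwards [hm.coeFn_toLp] with ξ hξ
  rw [hξ, norm_sq_quarterDeriv]

theorem L4Norm_le_absDNorm (h : sobolevPlus) :
    L4Norm (h : hardySpace) ≤ absDNorm (1 / 4) (h : hardySpace) :=
  ENNReal.toReal_mono (memLp_quarterDeriv h).2.ne (eLpNorm_four_le h)

theorem L4Norm_pos {h : sobolevPlus} (h0 : h ≠ 0) : 0 < L4Norm (h : hardySpace) := by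
  refine ENNReal.toReal_pos ?_ ((eLpNorm_four_le h).trans_lt (memLp_quarterDeriv h).2).ne
  rw [Ne, eLpNorm_eq_zero_iff (Lp.aestronglyMeasurable _) (by norm_num)]
  intro hz
  refine h0 (Subtype.ext (Subtype.ext (Lp.ext ?_)))
  exact hz.trans (Lp.coeFn_zero ℂ 2 (volume : Measure ℝ)).symm

theorem integral_mul_norm_sq_le (u : Lp ℝ 2 (volume : Measure ℝ)) (h : sobolevPlus) :
    ∫ x, u x * ‖((h : hardySpace) : L2) x‖ ^ 2 ≤ ‖u‖ * L4Norm (h : hardySpace) ^ 2 := by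
  set f : L2 := ((h : hardySpace) : L2)
  have h5 := eLpNorm_norm_rpow (p := 2) (μ := (volume : Measure ℝ)) (f : ℝ → ℂ)
    (q := 2) (by norm_num)
  have h6 : eLpNorm (fun x => ‖f x‖ ^ 2) 2 volume = eLpNorm (f : ℝ → ℂ) 4 volume ^ 2 := by
    rw [← ENNReal.rpow_natCast]
    norm_num at h5 ⊢
    exact h5
  have hfin : eLpNorm (f : ℝ → ℂ) 4 volume < ⊤ :=
    (eLpNorm_four_le h).trans_lt (memLp_quarterDeriv h).2
  have hm : MemLp (fun x => ‖f x‖ ^ 2) 2 volume :=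
    ⟨(Lp.aestronglyMeasurable f).norm.pow 2, by rw [h6]; exact ENNReal.pow_lt_top hfin⟩
  have e : ‖hm.toLp _‖ = L4Norm f ^ 2 := by
    rw [Lp.norm_toLp, h6, ENNReal.toReal_pow, L4Norm]
  rw [← e]
  refine le_trans (le_of_eq ?_) (real_inner_le_norm u (hm.toLp _))
  rw [L2.inner_def]
  apply integral_congr_ae
  filter_upwards [hm.coeFn_toLp] with x hx
  rw [hx]
  simp [mul_comm]

/-- If `‖h‖_{L⁴} ≤ κ ‖ |D|^{1/4} h ‖_{L²}`, then `⟨L_u h, h⟩ ≥ -(κ⁴ / 4) ‖u‖² ‖h‖²`: with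
`c = κ² ‖u‖`, integrate the pointwise inequality `c √s ≤ s + c² / 4` against `|ĥ|²`. -/
theorem form_lower_bound (u : Lp ℝ 2 (volume : Measure ℝ)) (h : sobolevPlus) {κ : ℝ}
    (hκ : L4Norm (h : hardySpace) ≤ κ * absDNorm (1 / 4) (h : hardySpace)) :
    -(κ ^ 4 / 4 * ‖u‖ ^ 2) * ‖(h : hardySpace)‖ ^ 2 ≤
      (inner ℂ (momentum h - toeplitzMap u h) (h : hardySpace)).re := by
  set f : L2 := ((h : hardySpace) : L2) with hf
  set fh : L2 := 𝓕 f with hfh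
  set c : ℝ := κ ^ 2 * ‖u‖ with hc
  have hD : (inner ℂ (momentum h) (h : hardySpace)).re =
      ∫ ξ : ℝ, 2 * Real.pi * ξ * ‖fh ξ‖ ^ 2 := by
    rw [inner_momentum, ← Complex.ofReal_re (∫ ξ : ℝ, 2 * Real.pi * ξ * ‖fh ξ‖ ^ 2),
      ← integral_complex_ofReal]
    congr 1
    apply integral_congr_ae
    filter_upwards with ξ
    rw [inner_self_eq_norm_sq_to_K, Complex.ofReal_mul (2 * Real.pi * ξ), Complex.ofReal_pow]
    rfl
  have hT : (inner ℂ (toeplitzMap u h) (h : hardySpace)).re = ∫ x, u x * ‖f x‖ ^ 2 := by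
    rw [inner_toeplitzMap, ← Complex.ofReal_re (∫ x, u x * ‖f x‖ ^ 2),
      ← integral_complex_ofReal]
    congr 1
    apply integral_congr_ae
    filter_upwards with x
    rw [inner_self_eq_norm_sq_to_K, Complex.ofReal_mul, Complex.ofReal_pow]
    rfl
  have hpos : ∀ᵐ ξ : ℝ, ξ < 0 → fh ξ = 0 := mem_hardySpace.mp (h : hardySpace).2
  have i1 : Integrable fun ξ : ℝ => √(2 * Real.pi * |ξ|) * ‖fh ξ‖ ^ 2 := by
    have := (memLp_quarterDeriv h).integrable_norm_pow (by norm_num)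
    refine this.congr (Filter.Eventually.of_forall fun ξ => ?_)
    exact_mod_cast norm_sq_quarterDeriv f ξ
  have i2 : Integrable fun ξ : ℝ => ‖fh ξ‖ ^ 2 := by
    exact_mod_cast (Lp.memLp fh).integrable_norm_pow (by norm_num)
  have i3 : Integrable fun ξ : ℝ => 2 * Real.pi * ξ * ‖fh ξ‖ ^ 2 := by
    have h1 := ((memLp_fourier_mul h).norm.integrable_mul (Lp.memLp fh).norm).const_mul
      (2 * Real.pi)
    refine h1.congr ?_
    filter_upwards [hpos] with ξ hξ
    rcases lt_or_ge ξ 0 with h0 | h0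
    · simp [hξ h0]
    · simp only [Pi.mul_apply, norm_mul, Complex.norm_real, Real.norm_of_nonneg h0]
      ring
  have hkey : c * absDNorm (1 / 4) f ^ 2 ≤
      (∫ ξ : ℝ, 2 * Real.pi * ξ * ‖fh ξ‖ ^ 2) + c ^ 2 / 4 * ‖(h : hardySpace)‖ ^ 2 := by
    have e : ‖(h : hardySpace)‖ ^ 2 = ∫ ξ : ℝ, ‖fh ξ‖ ^ 2 := by
      rw [← norm_sq_eq_integral, hfh, Lp.norm_fourier_eq]
      rfl
    rw [absDNorm_sq, e, ← integral_const_mul, ← integral_const_mul,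
      ← integral_add i3 (i2.const_mul _)]
    refine integral_mono_ae (i1.const_mul c) (i3.add (i2.const_mul _)) ?_
    filter_upwards [hpos] with ξ hξ
    rcases lt_or_ge ξ 0 with h0 | h0
    · have := hξ h0
      rw [hfh] at this
      simp [← hf, hfh, this]
    · have h1 : 0 ≤ 2 * Real.pi * ξ := mul_nonneg Real.two_pi_pos.le h0
      have h2 := Real.sq_sqrt h1
      simp only [abs_of_nonneg h0, ← hf, ← hfh]
      have h3 : c * √(2 * Real.pi * ξ) ≤ 2 * Real.pi * ξ + c ^ 2 / 4 := by
        nlinarith [sq_nonneg (√(2 * Real.pi * ξ) - c / 2)]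
      calc _ = (c * √(2 * Real.pi * ξ)) * ‖fh ξ‖ ^ 2 := by ring
        _ ≤ (2 * Real.pi * ξ + c ^ 2 / 4) * ‖fh ξ‖ ^ 2 := by gcongr
        _ = _ := by ring
  have hL4 : L4Norm f ^ 2 ≤ κ ^ 2 * absDNorm (1 / 4) f ^ 2 := by
    rw [← mul_pow]
    exact pow_le_pow_left₀ ENNReal.toReal_nonneg hκ 2
  have hu := integral_mul_norm_sq_le u h
  rw [inner_sub_left, Complex.sub_re, hD, hT]
  have h7 : ‖u‖ * L4Norm f ^ 2 ≤ c * absDNorm (1 / 4) f ^ 2 := by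
    calc ‖u‖ * L4Norm f ^ 2 ≤ ‖u‖ * (κ ^ 2 * absDNorm (1 / 4) f ^ 2) := by gcongr
      _ = _ := by rw [hc]; ring
  have h8 : c ^ 2 / 4 = κ ^ 4 / 4 * ‖u‖ ^ 2 := by rw [hc]; ring
  rw [h8] at hkey
  linarith [hu.trans h7]

theorem L4Norm_div_absDNorm_le_one (h : sobolevPlus) :
    L4Norm (h : hardySpace) / absDNorm (1 / 4) (h : hardySpace) ≤ 1 :=
  div_le_one_of_le₀ (L4Norm_le_absDNorm h) ENNReal.toReal_nonneg

theorem sobolevSup_nonneg : 0 ≤ sobolevSup :=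
  Real.iSup_nonneg fun _ => div_nonneg ENNReal.toReal_nonneg ENNReal.toReal_nonneg

theorem sobolevSup_le_one : sobolevSup ≤ 1 :=
  Real.iSup_le (fun f => L4Norm_div_absDNorm_le_one f.1) zero_le_one

theorem L4Norm_le_sobolevSup_mul {h : sobolevPlus} (h0 : h ≠ 0) :
    L4Norm (h : hardySpace) ≤ sobolevSup * absDNorm (1 / 4) (h : hardySpace) := by
  have hpos : 0 < absDNorm (1 / 4) (h : hardySpace) :=
    (L4Norm_pos h0).trans_le (L4Norm_le_absDNorm h)
  rw [← div_le_iff₀ hpos]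
  exact le_ciSup (f := fun f : {f : sobolevPlus // f ≠ 0} =>
      L4Norm ((f : sobolevPlus) : hardySpace) / absDNorm (1 / 4) ((f : sobolevPlus) : hardySpace))
    ⟨1, by rintro _ ⟨f, rfl⟩; exact L4Norm_div_absDNorm_le_one f.1⟩ ⟨h, h0⟩

theorem one_le_sobolevInf {h : sobolevPlus} (h0 : h ≠ 0) : 1 ≤ sobolevInf := by
  have : Nonempty {f : sobolevPlus // f ≠ 0} := ⟨⟨h, h0⟩⟩
  refine le_ciInf fun f => ?_
  rw [one_le_div (L4Norm_pos f.2)]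
  exact L4Norm_le_absDNorm f.1

end Form

/-! ### Approximate eigenvectors -/

section Approx

/-- Every `s ≥ 0` is an approximate eigenvalue of `L_u`. The approximate eigenvectors have the
indicator function of `[s / 2π, s / 2π + δ]` as Fourier transform; the term `T_u h` is small because
`‖ĥ‖_{L¹} = √δ ‖h‖_{L²}`. -/
theorem exists_approx_eigenvector (u : Lp ℝ 2 (volume : Measure ℝ)) {s : ℝ} (hs : 0 ≤ s) {ε : ℝ}
    (hε : 0 < ε) : ∃ h : sobolevPlus, (h : hardySpace) ≠ 0 ∧
      ‖(s : ℂ) • (h : hardySpace) - (momentum h - toeplitzMap u h)‖ ≤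
        ε * ‖(h : hardySpace)‖ := by
  obtain ⟨δ, hδ, hδε⟩ : ∃ δ : ℝ, 0 < δ ∧ 2 * Real.pi * δ + √δ * ‖u‖ ≤ ε := by
    have hcont : Continuous fun δ : ℝ => 2 * Real.pi * δ + √δ * ‖u‖ := by fun_prop
    have hlim := hcont.tendsto 0
    simp only [mul_zero, Real.sqrt_zero, zero_mul, add_zero] at hlim
    have h1 := (hlim.mono_left (nhdsWithin_le_nhds (s := Set.Ioi 0))).eventually
      (eventually_le_nhds hε)
    obtain ⟨δ, h2, h3⟩ := (h1.and self_mem_nhdsWithin).exists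
    exact ⟨δ, h3, h2⟩
  set a : ℝ := s / (2 * Real.pi) with ha
  have ha0 : 0 ≤ a := div_nonneg hs Real.two_pi_pos.le
  have hsa : s = 2 * Real.pi * a := by
    rw [ha]
    field_simp
  set I : Set ℝ := Set.Icc a (a + δ) with hI
  have hvol : volume I ≠ ⊤ := by rw [hI, Real.volume_Icc]; exact ENNReal.ofReal_ne_top
  set g : L2 := indicatorConstLp 2 measurableSet_Icc hvol (1 : ℂ) with hg
  have hgI : (g : ℝ → ℂ) =ᵐ[volume] I.indicator fun _ => (1 : ℂ) := indicatorConstLp_coeFn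
  have hFg : (𝓕 (𝓕⁻ g : L2) : L2) = g := fourier_fourierInv_eq g
  have hmem : (𝓕⁻ g : L2) ∈ hardySpace := by
    rw [mem_hardySpace, hFg]
    filter_upwards [hgI] with ξ h1 hξ
    rw [h1, Set.indicator_of_notMem]
    intro h2
    have := h2.1
    linarith
  have hsob : (⟨𝓕⁻ g, hmem⟩ : hardySpace) ∈ sobolevPlus := by
    refine memSobolev_of_memLp ?_
    change MemLp (fun ξ : ℝ => (ξ : ℂ) * (𝓕 (𝓕⁻ g : L2) : L2) ξ) 2 volume
    rw [hFg]
    refine MemLp.mono ((Lp.memLp g).const_mul ((a + δ : ℝ) : ℂ))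
      (Complex.continuous_ofReal.aestronglyMeasurable.mul (Lp.aestronglyMeasurable _)) ?_
    filter_upwards [hgI] with ξ h1
    rw [h1]
    by_cases hξ : ξ ∈ I
    · rw [Set.indicator_of_mem hξ, norm_mul, norm_mul, Complex.norm_real, Complex.norm_real,
        Real.norm_of_nonneg (ha0.trans hξ.1), Real.norm_of_nonneg (by positivity)]
      gcongr
      exact hξ.2
    · simp [Set.indicator_of_notMem hξ]
  set h : sobolevPlus := ⟨⟨𝓕⁻ g, hmem⟩, hsob⟩ with hh
  have hnorm : ‖(h : hardySpace)‖ = √δ := by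
    change ‖(𝓕⁻ g : L2)‖ = _
    rw [← Lp.norm_fourier_eq, hFg, hg, norm_indicatorConstLp (by norm_num) (by norm_num),
      Measure.real, Real.volume_Icc, add_sub_cancel_left, ENNReal.toReal_ofReal hδ.le,
      Real.sqrt_eq_rpow]
    simp
  have hsδ : 0 < √δ := Real.sqrt_pos.mpr hδ
  refine ⟨h, ?_, ?_⟩
  · rw [← norm_pos_iff, hnorm]
    exact hsδ
  have hT : ‖toeplitzMap u h‖ ≤ √δ * ‖u‖ * ‖(h : hardySpace)‖ := by
    refine (norm_szego_le _).trans ((norm_mulBy_le u h).trans_eq ?_)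
    have e : ∫ ξ, ‖(𝓕 ((h : hardySpace) : L2) : L2) ξ‖ = δ := by
      change ∫ ξ, ‖(𝓕 (𝓕⁻ g : L2) : L2) ξ‖ = δ
      rw [hFg]
      have e1 : ∫ ξ, ‖g ξ‖ = ∫ ξ, I.indicator (fun _ => (1 : ℝ)) ξ := by
        apply integral_congr_ae
        filter_upwards [hgI] with ξ h1
        rw [h1]
        by_cases hξ : ξ ∈ I <;> simp [hξ]
      rw [e1, integral_indicator measurableSet_Icc, setIntegral_const]
      simp [hδ.le]
    rw [e, hnorm]
    rw [mul_right_comm, Real.mul_self_sqrt hδ.le]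
  have hD : ‖(s : ℂ) • (h : hardySpace) - momentum h‖ ≤
      2 * Real.pi * δ * ‖(h : hardySpace)‖ := by
    change ‖(s : ℂ) • (𝓕⁻ g : L2) - (momentum h : L2)‖ ≤ 2 * Real.pi * δ * ‖(𝓕⁻ g : L2)‖
    rw [← Lp.norm_fourier_eq, ← Lp.norm_fourier_eq (𝓕⁻ g : L2), hFg]
    have e2 : (𝓕 ((s : ℂ) • (𝓕⁻ g : L2) - (momentum h : L2)) : L2) =
        (s : ℂ) • g - (𝓕 (momentum h : L2) : L2) := by
      refine ((Lp.fourierTransformₗᵢ ℝ ℂ).map_sub _ _).trans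
        (congrArg (· - _) (((Lp.fourierTransformₗᵢ ℝ ℂ).map_smul (s : ℂ) _).trans ?_))
      exact congrArg ((s : ℂ) • ·) hFg
    rw [e2]
    refine Lp.norm_le_mul_norm_of_ae_le_mul ?_
    filter_upwards [Lp.coeFn_sub ((s : ℂ) • g) (𝓕 (momentum h : L2) : L2),
      Lp.coeFn_smul (s : ℂ) g, fourier_momentum h, hgI] with ξ h1 h2 h3 h4
    change _ = _ * (𝓕 (𝓕⁻ g : L2) : L2) ξ at h3
    rw [hFg] at h3
    rw [h1, Pi.sub_apply, h2, Pi.smul_apply, h3, h4]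
    by_cases hξ : ξ ∈ I
    · rw [Set.indicator_of_mem hξ, smul_eq_mul, mul_one, mul_one, ← Complex.ofReal_sub,
        Complex.norm_real, norm_one, mul_one, hsa, ← mul_sub, norm_mul,
        Real.norm_of_nonneg Real.two_pi_pos.le]
      gcongr
      rw [Real.norm_eq_abs, abs_le]
      constructor <;> linarith [hξ.1, hξ.2]
    · simp [Set.indicator_of_notMem hξ]
  calc ‖(s : ℂ) • (h : hardySpace) - (momentum h - toeplitzMap u h)‖
      = ‖((s : ℂ) • (h : hardySpace) - momentum h) + toeplitzMap u h‖ := by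
        congr 1
        abel
    _ ≤ 2 * Real.pi * δ * ‖(h : hardySpace)‖ + √δ * ‖u‖ * ‖(h : hardySpace)‖ :=
        (norm_add_le _ _).trans (add_le_add hD hT)
    _ ≤ ε * ‖(h : hardySpace)‖ := by
        rw [← add_mul]
        gcongr

end Approx

/-! ### Self-adjointness and the essential spectrum -/

section Conclusion

theorem form_lower_bound_one (u : Lp ℝ 2 (volume : Measure ℝ)) (h : sobolevPlus) :
    -(1 / 4 * ‖u‖ ^ 2) * ‖(h : hardySpace)‖ ^ 2 ≤
      (inner ℂ (momentum h - toeplitzMap u h) (h : hardySpace)).re := by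
  have := form_lower_bound u h (κ := 1) (by rw [one_mul]; exact L4Norm_le_absDNorm h)
  rwa [one_pow] at this

theorem isSelfAdjoint_lax (u : Lp ℝ 2 (volume : Measure ℝ)) :
    IsSelfAdjoint
      (⟨sobolevPlus, momentum - toeplitzMap u⟩ : hardySpace →ₗ.[ℂ] hardySpace) := by
  -- a point below the lower bound of the quadratic form, which cannot be an eigenvalue
  set c : ℝ := -(1 / 4 * ‖u‖ ^ 2) - 1 with hc
  have hc0 : c < 0 := by
    have : 0 ≤ ‖u‖ ^ 2 := by positivity
    linarith
  refine isSelfAdjoint_of_mem_resolventSet (isFormalAdjoint_lax u) (c := c) ?_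
  have hcS : (c : ℂ) ∉ Complex.ofReal '' Set.Ici (0 : ℝ) := by
    rintro ⟨r, hr, hrc⟩
    rw [Complex.ofReal_injective hrc] at hr
    exact absurd hr (not_le.mpr hc0)
  refine (mem_resolventSet_or_mem_pointSpectrum (relCompactAt_toeplitzMap u hcS)).resolve_right ?_
  intro hpp
  obtain ⟨r, hr, hrc⟩ := pointSpectrum_subset_Ici (isFormalAdjoint_lax u)
    (fun h _ => form_lower_bound_one u h) hpp
  rw [Complex.ofReal_injective hrc, Set.mem_Ici] at hr
  linarith

theorem essentialSpectrum_lax (u : Lp ℝ 2 (volume : Measure ℝ)) :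
    essentialSpectrum
      (⟨sobolevPlus, momentum - toeplitzMap u⟩ : hardySpace →ₗ.[ℂ] hardySpace) =
        Complex.ofReal '' Set.Ici 0 := by
  refine essentialSpectrum_eq_of_relCompactAt (isFormalAdjoint_lax u) isClosed_ofReal_Ici ?_
    (fun z hz => relCompactAt_toeplitzMap u hz) ?_
  · rintro _ ⟨s, hs, rfl⟩ ε hε
    refine ⟨((s + ε / 2 : ℝ) : ℂ), ⟨s + ε / 2, ?_, rfl⟩, ?_, ?_⟩
    · have : 0 ≤ s := hs
      exact Set.mem_Ici.mpr (by linarith)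
    · rw [Metric.mem_ball, dist_eq_norm, ← Complex.ofReal_sub, Complex.norm_real,
        add_sub_cancel_left, Real.norm_of_nonneg (by positivity)]
      linarith
    · intro h
      have := Complex.ofReal_injective h
      linarith
  · rintro _ ⟨s, hs, rfl⟩ ε hε
    exact exists_approx_eigenvector u hs hε

theorem essentialSpectrum_opD : essentialSpectrum opD = Complex.ofReal '' Set.Ici 0 := by
  have h := essentialSpectrum_lax 0
  rwa [toeplitzMap_zero, sub_zero, ← opD_eq] at h

end Conclusion

end LaxOperator

theorem mainTheorem7 (u : MeasureTheory.Lp ℝ 2 (MeasureTheory.volume : MeasureTheory.Measure ℝ)) :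
    -- `L_u` is self-adjoint on `L²₊` with domain `H¹₊`
    (LaxOperator.lax u).domain = LaxOperator.sobolevPlus ∧
    IsSelfAdjoint (LaxOperator.lax u) ∧
    -- `L_u` is bounded from below
    (∃ m : ℝ, ∀ h : (LaxOperator.lax u).domain,
      m * ‖(h : LaxOperator.hardySpace)‖ ^ 2 ≤
        (inner ℂ (LaxOperator.lax u h) (h : LaxOperator.hardySpace)).re) ∧
    -- the essential spectrum of `L_u` and of `D`
    LaxOperator.essentialSpectrum (LaxOperator.lax u) =
      LaxOperator.essentialSpectrum LaxOperator.opD ∧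
    LaxOperator.essentialSpectrum LaxOperator.opD = Complex.ofReal '' Set.Ici 0 ∧
    -- location of the eigenvalues, for the infimum of the Sobolev quotient and for the best
    -- constant in the Sobolev inequality
    LaxOperator.pointSpectrum (LaxOperator.lax u) ⊆
      Complex.ofReal '' Set.Ici (-(LaxOperator.sobolevInf ^ 2 / 4 * ‖u‖ ^ 2)) ∧
    LaxOperator.pointSpectrum (LaxOperator.lax u) ⊆
      Complex.ofReal '' Set.Ici (-(LaxOperator.sobolevSup ^ 2 / 4 * ‖u‖ ^ 2)) := by
  rw [LaxOperator.lax_eq]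
  refine ⟨rfl, LaxOperator.isSelfAdjoint_lax u,
    ⟨_, fun h => LaxOperator.form_lower_bound_one u h⟩,
    (LaxOperator.essentialSpectrum_lax u).trans LaxOperator.essentialSpectrum_opD.symm,
    LaxOperator.essentialSpectrum_opD, fun z hz => ?_, fun z hz => ?_⟩
  · refine LaxOperator.pointSpectrum_subset_Ici (LaxOperator.isFormalAdjoint_lax u) (fun h h0 =>
      le_trans ?_ (LaxOperator.form_lower_bound_one u h)) hz
    -- the Sobolev quotient is at least `1`, hence so is its infimum
    have h1 := pow_le_pow_left₀ zero_le_one (LaxOperator.one_le_sobolevInf h0) 2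
    rw [one_pow] at h1
    gcongr
  · refine LaxOperator.pointSpectrum_subset_Ici (LaxOperator.isFormalAdjoint_lax u) (fun h h0 =>
      le_trans ?_ (LaxOperator.form_lower_bound u h (LaxOperator.L4Norm_le_sobolevSup_mul h0))) hz
    -- the best constant `K` satisfies `K⁴ ≤ K²`, as it is at most `1`
    have h1 : LaxOperator.sobolevSup ^ 4 ≤ LaxOperator.sobolevSup ^ 2 :=
      pow_le_pow_of_le_one LaxOperator.sobolevSup_nonneg LaxOperator.sobolevSup_le_one
        (by norm_num)
    gcongr
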